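/- Let $a,b,c\in\mathbb R$ and $p(x)=x^3+ax^2+bx+c$. Put $$c_0=-\tfrac{2}{27}a^3+\tfrac13ab,\qquad c_{1,2}=c_0\pm\tfrac{2}{27}\sqrt{(a^2-3b)^3},\qquad \mu_{1,2}=-\tfrac a3\pm\tfrac{\sqrt3}{3}\sqrt{\tfrac{a^2}{3}-b},\qquad \xi_{1,2}=-\tfrac a3\mp\tfrac{2\sqrt3}{3}\sqrt{\tfrac{a^2}{3}-b},$$ $$\rho_0=-\tfrac a3,\qquad \rho_{1,2}=-\tfrac a3\pm\sqrt{\tfrac{a^2}{3}-b},\qquad \lambda_{1,2}=-\tfrac a2\pm\sqrt{\tfrac{a^2}{4}-b}$$ (used only where the radicands are non-negative), and write $s=\sqrt{-b}$ when $b\le 0$. For each of the 17 ranges of $(a,b)$ below, exactly one of the listed conditions on $-c$ holds, and the statement attached to it is true. Roots are counted with multiplicity. "One root" means that $p$ has exactly one real root $x_1$ (and two non-real ones). In the other cases $p$ has three real roots $x_3\le x_2\le x_1$; the three signs are listed in the order $x_3,x_2,x_1$, and each of the three displayed intervals contains no real root of $p$ other than the value of the root $x_i$ assigned to it. The signs are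 $-$ (negative), $+$ (positive), $\le0$ (non-positive), $\ge 0$ (non-negative). The symbol $<_{P}$ means: $\le$ always, and $<$ unless the condition $P$ holds. **$a=0,\ b<0$.** Here $c_1=-c_2=\frac{2\sqrt3}{9}\sqrt{-b^3}$, $\mu_1=-\mu_2=\frac{\sqrt3}{3}s$, $\xi_2=-\xi_1=\frac{2\sqrt3}{3}s$. 1. $-c<-c_1$: one root, $-$; $-(1+\max\{|b|,c\})<x_1<\xi_1$. 2. $-c_1\le -c<0$: signs $-,+,+$; $\xi_1\le x_3<-s$; $-c/b<x_2\le\mu_1$; $\mu_1\le x_1<s$. 3. $0\le -c\le -c_2$: signs $-,\le0,+$; $-s\le x_3\le\mu_2$; $\mu_2\le x_2\le -c/b$; $s\le x_1\le\xi_2$. 4. $-c_2<-c$: one root, $+$; $\xi_2<x_1<1+\max\{|b|,|c|\}$. **$a=0,\ b=0$.** 1. $-c<0$: one root, $-$; $x_1=\sqrt[3]{-c}$. 2. $-c=0$: $x_1=x_2=x_3=0$. 3. $-c>0$: one root, $+$; $x_1=\sqrt[3]{-c}$. (Here $\sqrt[3]{\cdot}$ is the real cube root.) **$a=0,\ b>0$.**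 1. $-c\le0$: one root, $\le0$; $-c/b<_{c=0}x_1\le0$. 2. $-c>0$: one root, $+$; $0<x_1<-c/b$. **$b<-a^2/9,\ a<0$.** 1. $-c<-c_1$: one root, $-$; $-(1+\sqrt{\max\{|b|,c\}})<x_1<\xi_1$. 2. $-c_1\le-c<-ab$: signs $-,+,+$; $\xi_1\le x_3<-s$; $\min\{-a,s\}<x_2\le\mu_1$; $\mu_1\le x_1<\max\{-a,s\}$. 3. $-ab\le-c<-c_0$: signs $-,+,+$; $-s\le x_3<\rho_2$; $\rho_0<x_2\le\min\{-c/b,s\}$; $\max\{-a,s\}\le x_1<\rho_1$. 4. $-c_0\le-c<0$: signs $-,+,+$; $\rho_2\le x_3<\lambda_2$; $0<x_2\le\min\{-c/b,\rho_0\}$; $\rho_1\le x_1<\lambda_1$. 5. $0\le-c\le-c_2$: signs $-,\le0,+$; $\lambda_2\le x_3\le\mu_2$; $\mu_2\le x_2\le-c/b$; $\lambda_1\le x_1\le\xi_2$. 6. $-c_2<-c$: one root, $+$; $\xi_2<x_1<1+\max\{|a|,|b|,|c|\}$. **$b<-a^2/9,\ a>0$.** 1. $-c<-c_1$: one root, $-$;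 $-(1+\max\{a,|b|,c\})<x_1<\xi_1$. 2. $-c_1\le-c<0$: signs $-,+,+$; $\xi_1\le x_3<\lambda_2$; $-c/b<x_2\le\mu_1$; $\mu_1\le x_1<\lambda_1$. 3. $0\le-c<-c_0$: signs $-,\le0,+$; $\lambda_2\le x_3<\rho_2$; $-c/b<_{c=0}x_2$ and $\rho_0<x_2\le0$; $\lambda_1\le x_1<\rho_1$. 4. $-c_0\le-c<-ab$: signs $-,-,+$; $\rho_2\le x_3<-a$; $\max\{-c/b,-s\}<x_2\le\rho_0$; $\rho_1\le x_1<s$. 5. $-ab\le-c\le-c_2$: signs $-,-,+$; $\min\{-a,-s\}\le x_3\le\mu_2$; $\mu_2\le x_2\le\max\{-a,-s\}$; $s\le x_1\le\xi_2$. 6. $-c_2<-c$: one root, $+$; $\xi_2<x_1<1+\sqrt{\max\{|b|,|c|\}}$. **$-a^2/9\le b<0,\ a<0$.** 1. $-c<-c_1$: one root, $-$; $-(1+\sqrt{\max\{|b|,c\}})<x_1<\xi_1$. 2. $-c_1\le-c<-c_0$: signs $-,+,+$; $\xi_1\le x_3<\rho_2$; $\rho_0<x_2\le\mu_1$; $\mu_1\le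 x_1<\rho_1$. 3. $-c_0\le-c<-ab$: signs $-,+,+$; $\rho_2\le x_3<-s$; $s<x_2\le\rho_0$; $\rho_1\le x_1<-a$. 4. $-ab\le-c<0$: signs $-,+,+$; $-s\le x_3<\lambda_2$; $0<x_2\le\min\{-c/b,s\}$; $-a\le x_1<\lambda_1$. 5. $0\le-c\le-c_2$: signs $-,\le0,+$; $\lambda_2\le x_3\le\mu_2$; $\mu_2\le x_2\le-c/b$; $\lambda_1\le x_1\le\xi_2$. 6. $-c_2<-c$: one root, $+$; $\xi_2<x_1<1+\max\{|a|,|b|,|c|\}$. **$-a^2/9\le b<0,\ a>0$.** 1. $-c<-c_1$: one root, $-$; $-(1+\max\{a,|b|,c\})<x_1<\xi_1$. 2. $-c_1\le-c<0$: signs $-,+,+$; $\xi_1\le x_3<\lambda_2$; $-c/b<x_2\le\mu_1$; $\mu_1\le x_1<\lambda_1$. 3. $0\le-c<-ab$: signs $-,\le0,+$; $\lambda_2\le x_3<-a$; $-c/b<_{c=0}x_2$ and $-s<x_2\le0$; $\lambda_1\le x_1<s$. 4. $-ab\le-c<-c_0$: signs $-,-,+$; $-a\le x_3<\rho_2$;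 $\rho_0<x_2\le-s$; $s\le x_1<\rho_1$. 5. $-c_0\le-c\le-c_2$: signs $-,-,+$; $\rho_2\le x_3\le\mu_2$; $\mu_2\le x_2\le\rho_0$; $\rho_1\le x_1\le\xi_2$. 6. $-c_2<-c$: one root, $+$; $\xi_2<x_1<1+\sqrt{\max\{|b|,|c|\}}$. **$b=0,\ a<0$.** Here $-c_1=\frac4{27}a^3$, $-c_0=\frac2{27}a^3$, $c_2=0$, $\xi_1=\frac a3$, $\mu_1=-\frac{2a}3$, $\rho_0=-\frac a3$, $\rho_1=\frac{(-1-\sqrt3)a}3$, $\rho_2=\frac{(-1+\sqrt3)a}3$. 1. $-c<-c_1$: one root, $-$; $-\max\{1,c\}<x_1<\xi_1$. 2. $-c_1\le-c<-c_0$: signs $-,+,+$; $\xi_1\le x_3<\rho_2$; $\rho_0<x_2\le\mu_1$; $\mu_1\le x_1<\rho_1$. 3. $-c_0\le-c\le0$: signs $\le0,\ge0,+$; $\rho_2\le x_3<_{c=0}0$; $0<_{c=0}x_2\le\rho_0$; $\rho_1\le x_1<_{c=0}-a$. 4. $0<-c$: one root, $+$; $-a<x_1<1+\max\{|a|,|c|\}$.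 **$b=0,\ a>0$.** Here $c_1=0$, $-c_0=\frac2{27}a^3$, $-c_2=\frac4{27}a^3$, $\xi_2=\frac a3$, $\mu_2=-\frac{2a}3$, $\rho_0=-\frac a3$, $\rho_1=\frac{(-1+\sqrt3)a}3$, $\rho_2=\frac{(-1-\sqrt3)a}3$. 1. $-c<0$: one root, $-$; $-(1+\max\{a,|c|\})<x_1<-a$. 2. $0\le-c<-c_0$: signs $-,\le0,\ge0$ (with $x_1>0$ unless $c=0$); $-a\le x_3<\rho_2$; $\rho_0<x_2\le0$; $0\le x_1<\rho_1$. 3. $-c_0\le-c\le-c_2$: signs $-,-,+$; $\rho_2\le x_3<_{c=c_2}\mu_2$; $\mu_2<_{c=c_2}x_2\le\rho_0$; $\rho_1\le x_1<_{c=c_2}\xi_2$. 4. $-c_2<-c$: one root, $+$; $\xi_2\le x_1<\max\{1,|c|\}$. **$0<b\le2a^2/9,\ a<0$.** 1. $-c<-c_1$: one root, $-$; $-c/b<x_1<\xi_1$. 2. $-c_1\le-c<-c_0$: signs $-,+,+$; $\max\{-c/b,\xi_1\}\le x_3<\rho_2$; $\rho_0<x_2\le\mu_1$; $\mu_1\le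 x_1<\rho_1$. 3. $-c_0\le-c<0$: signs $-,+,+$; $\max\{-c/b,\rho_2\}\le x_3<0$; $\lambda_2<x_2\le\rho_0$; $\rho_1\le x_1<\lambda_1$. 4. $0\le-c\le-c_2$: signs $\ge0,+,+$; $-c/b\le x_3\le\mu_2$; $\mu_2\le x_2\le\lambda_2$; $\lambda_1\le x_1\le\xi_2$. 5. $-c_2<-c<-ab$: one root, $+$; $\max\{-c/b,\xi_2\}<x_1<-a$. 6. $-ab\le-c$: one root, $+$; $-a\le x_1<_{c=ab}-c/b$. **$0<b\le2a^2/9,\ a>0$.** 1. $-c<-ab$: one root, $-$; $-c/b<x_1<-a$. 2. $-ab\le-c<-c_1$: one root, $-$; $-a\le x_1<_{c=ab}-c/b$ and $x_1<\xi_1$. 3. $-c_1\le-c<0$: signs $-,-,-$; $\xi_1\le x_3<\lambda_2$; $\lambda_1<x_2\le\mu_1$; $\mu_1\le x_1<-c/b$. 4. $0\le-c<-c_0$: signs $-,-,\ge0$; $\lambda_2\le x_3<\rho_2$; $\rho_0<x_2\le\lambda_1$; $0\le x_1<_{c=0}-c/b$ and $x_1<\rho_1$. 5. $-c_0\le-c\le-c_2$: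 signs $-,-,\ge0$ (with $x_1>0$ unless $c=0$); $\rho_2\le x_3\le\mu_2$; $\mu_2\le x_2\le\rho_0$; $\rho_1\le x_1\le\min\{-c/b,\xi_2\}$. 6. $-c_2<-c$: one root, $+$; $\xi_2<x_1<-c/b$. **$2a^2/9<b\le a^2/4,\ a<0$.** 1. $-c<-c_1$: one root, $-$; $-c/b<x_1<\xi_1$. 2. $-c_1\le-c<0$: signs $-,+,+$; $\max\{-c/b,\xi_1\}\le x_3<0$; $\lambda_2<x_2\le\mu_1$; $\mu_1\le x_1<\lambda_1$. 3. $0\le-c<-c_0$: signs $\ge0,+,+$; $-c/b\le x_3<\rho_2$; $\rho_0<x_2\le\lambda_2$; $\lambda_1\le x_1<\rho_1$. 4. $-c_0\le-c\le-c_2$: signs $+,+,+$; $\max\{\rho_2,-c/b\}\le x_3\le\mu_2$; $\mu_2\le x_2\le\rho_0$; $\rho_1\le x_1\le\xi_2$. 5. $-c_2<-c\le-ab$: one root, $+$; $-c/b<_{c=ab}x_1$ and $\xi_2<x_1\le-a$. 6. $-ab<-c$: one root, $+$; $-a<x_1<-c/b$. **$2a^2/9<b\le a^2/4,\ a>0$.**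 1. $-c<-ab$: one root, $-$; $-c/b<x_1<-a$. 2. $-ab\le-c<-c_1$: one root, $-$; $-a\le x_1<_{c=ab}-c/b$ and $x_1<\xi_1$. 3. $-c_1\le-c<-c_0$: signs $-,-,-$; $\xi_1\le x_3<\rho_2$; $\rho_0<x_2\le\mu_1$; $\mu_1\le x_1<\min\{-c/b,\rho_1\}$. 4. $-c_0\le-c<0$: signs $-,-,-$; $\rho_2\le x_3<\lambda_2$; $\lambda_1<x_2\le\rho_0$; $\rho_1\le x_1<-c/b$. 5. $0\le-c\le-c_2$: signs $-,-,\ge0$; $\lambda_2\le x_3\le\mu_2$; $\mu_2\le x_2\le\lambda_1$; $0\le x_1\le\min\{-c/b,\xi_2\}$. 6. $-c_2<-c$: one root, $+$; $\xi_2<x_1<-c/b$. **$a^2/4<b\le a^2/3,\ a<0$.** 1. $-c<0$: one root, $-$; $-c/b<x_1<0$. 2. $0\le-c<-c_1$: one root, $\ge0$; $-c/b\le x_1<\xi_1$. 3. $-c_1\le-c<-c_0$: signs $+,+,+$; $\max\{-c/b,\xi_1\}\le x_3<\rho_2$; $\rho_0<x_2\le\mu_1$; $\mu_1\le x_1<\rho_1$.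 4. $-c_0\le-c\le-c_2$: signs $+,+,+$; $\max\{-c/b,\rho_2\}\le x_3\le\mu_2$; $\mu_2\le x_2\le\rho_0$; $\rho_1\le x_1\le\xi_2$. 5. $-c_2<-c\le-ab$: one root, $+$; $-c/b<_{c=ab}x_1$ and $\xi_2<x_1\le-a$. 6. $-ab<-c$: one root, $+$; $-a<x_1<-c/b$. **$a^2/4<b\le a^2/3,\ a>0$.** 1. $-c<-ab$: one root, $-$; $-c/b<x_1<-a$. 2. $-ab\le-c<-c_1$: one root, $-$; $-a\le x_1<_{c=ab}-c/b$ and $x_1<\xi_1$. 3. $-c_1\le-c<-c_0$: signs $-,-,-$; $\xi_1\le x_3<\rho_2$; $\rho_0<x_2\le\mu_1$; $\mu_1\le x_1<\min\{-c/b,\rho_1\}$. 4. $-c_0\le-c\le-c_2$: signs $-,-,-$; $\rho_2\le x_3\le\mu_2$; $\mu_2\le x_2\le\rho_0$; $\rho_1\le x_1<-c/b$ and $x_1<_{c=c_2}\xi_2$. 5. $-c_2<-c\le0$: one root, $\le0$; $\xi_2<x_1\le-c/b$. 6. $0<-c$: one root, $+$; $0<x_1<-c/b$. **$b>a^2/3,\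 a<0$.** 1. $-c<0$: one root, $-$; $-c/b<x_1<0$. 2. $0\le-c<-c_0$: one root, $\ge0$; $-c/b\le x_1<\rho_0$. 3. $-c_0\le-c<-ab$: one root, $+$; $\max\{-c/b,\rho_0\}\le x_1<-a$. 4. $-ab\le-c$: one root, $+$; $-a\le x_1<_{c=ab}-c/b$. **$b>a^2/3,\ a>0$.** 1. $-c<-ab$: one root, $-$; $-c/b<x_1<-a$. 2. $-ab\le-c<-c_0$: one root, $-$; $-a\le x_1<_{c=ab}-c/b$ and $x_1<\rho_0$. 3. $-c_0\le-c<0$: one root, $-$; $\rho_0\le x_1<-c/b$. 4. $0\le-c$: one root, $\ge0$; $0\le x_1<_{c=0}-c/b$. -/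

import Mathlib

open Set Polynomial

noncomputable section

namespace MonicCubic

/-- The monic cubic `x³ + a x² + b x + c`. -/
def cubic (a b c : ℝ) : ℝ[X] := X ^ 3 + C a * X ^ 2 + C b * X + C c

/-- The real cube root. -/
def realCbrt (y : ℝ) : ℝ :=
  if 0 ≤ y then y ^ (1 / 3 : ℝ) else -((-y) ^ (1 / 3 : ℝ))

/-- The free term for which `-a / 3` is a root. -/
def c₀ (a b : ℝ) : ℝ := -(2 / 27) * a ^ 3 + (1 / 3) * a * b

/-- The larger root `c` of the discriminant; meaningful for `b ≤ a² / 3`. -/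
def c₁ (a b : ℝ) : ℝ := c₀ a b + (2 / 27) * √((a ^ 2 - 3 * b) ^ 3)

/-- The smaller root `c` of the discriminant; meaningful for `b ≤ a² / 3`. -/
def c₂ (a b : ℝ) : ℝ := c₀ a b - (2 / 27) * √((a ^ 2 - 3 * b) ^ 3)

/-- The larger critical point (for `b ≤ a² / 3`): the double root for `c = c₁`. -/
def μ₁ (a b : ℝ) : ℝ := -a / 3 + (√3 / 3) * √(a ^ 2 / 3 - b)

/-- The smaller critical point (for `b ≤ a² / 3`): the double root for `c = c₂`. -/
def μ₂ (a b : ℝ) : ℝ := -a / 3 - (√3 / 3) * √(a ^ 2 / 3 - b)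

/-- The simple root for `c = c₁`. -/
def ξ₁ (a b : ℝ) : ℝ := -a / 3 - (2 * √3 / 3) * √(a ^ 2 / 3 - b)

/-- The simple root for `c = c₂`. -/
def ξ₂ (a b : ℝ) : ℝ := -a / 3 + (2 * √3 / 3) * √(a ^ 2 / 3 - b)

/-- The middle root for `c = c₀`. -/
def ρ₀ (a : ℝ) : ℝ := -a / 3

/-- The largest root for `c = c₀` (for `b ≤ a² / 3`). -/
def ρ₁ (a b : ℝ) : ℝ := -a / 3 + √(a ^ 2 / 3 - b)

/-- The smallest root for `c = c₀` (for `b ≤ a² / 3`). -/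
def ρ₂ (a b : ℝ) : ℝ := -a / 3 - √(a ^ 2 / 3 - b)

/-- The larger root of `x² + a x + b` (for `b ≤ a² / 4`). -/
def lam₁ (a b : ℝ) : ℝ := -a / 2 + √(a ^ 2 / 4 - b)

/-- The smaller root of `x² + a x + b` (for `b ≤ a² / 4`). -/
def lam₂ (a b : ℝ) : ℝ := -a / 2 - √(a ^ 2 / 4 - b)

/-- `x < y`, where equality is also allowed in the boundary case `P`. -/
def LtUnless (P : Prop) (x y : ℝ) : Prop := x ≤ y ∧ (¬ P → x < y)

/-- The cubic has exactly one real root `x₁`, counted with multiplicity (so the other two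
complex roots are not real); it has the sign prescribed by `S₁` and lies in `I₁`. -/
def OneRoot (a b c : ℝ) (S₁ I₁ : Set ℝ) : Prop :=
  ∃ x₁ : ℝ, (cubic a b c).roots = {x₁} ∧ x₁ ∈ S₁ ∧ x₁ ∈ I₁

/-- The cubic has three real roots `x₃ ≤ x₂ ≤ x₁`, counted with multiplicity; `xᵢ` has the sign
prescribed by `Sᵢ`, lies in `Iᵢ`, and is the only root in `Iᵢ`. -/
def ThreeRoots (a b c : ℝ) (S₃ S₂ S₁ I₃ I₂ I₁ : Set ℝ) : Prop :=
  ∃ x₃ x₂ x₁ : ℝ, x₃ ≤ x₂ ∧ x₂ ≤ x₁ ∧ (cubic a b c).roots = {x₃, x₂, x₁} ∧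
    x₃ ∈ S₃ ∧ x₂ ∈ S₂ ∧ x₁ ∈ S₁ ∧
    x₃ ∈ I₃ ∧ x₂ ∈ I₂ ∧ x₁ ∈ I₁ ∧
    (∀ y ∈ (cubic a b c).roots, y ∈ I₃ → y = x₃) ∧
    (∀ y ∈ (cubic a b c).roots, y ∈ I₂ → y = x₂) ∧
    (∀ y ∈ (cubic a b c).roots, y ∈ I₁ → y = x₁)

/-- A list of pairs (condition, conclusion) is a valid classification: some condition holds, no
two of them hold together, and each condition implies its conclusion. -/
def Valid (cases : List (Prop × Prop)) : Prop :=
  (∃ p ∈ cases, p.1) ∧ cases.Pairwise (fun p q => ¬ (p.1 ∧ q.1)) ∧ ∀ p ∈ cases, p.1 → p.2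

/-- The cases for `a = 0`, `b < 0`. -/
def depressedNeg (a b c : ℝ) : List (Prop × Prop) :=
  [ (-c < -c₁ a b,
      OneRoot a b c (Iio 0) {x | -(1 + max |b| c) < x ∧ x < ξ₁ a b}),
    (-c₁ a b ≤ -c ∧ -c < 0,
      ThreeRoots a b c (Iio 0) (Ioi 0) (Ioi 0)
        {x | ξ₁ a b ≤ x ∧ x < -√(-b)}
        {x | -c / b < x ∧ x ≤ μ₁ a b}
        {x | μ₁ a b ≤ x ∧ x < √(-b)}),
    (0 ≤ -c ∧ -c ≤ -c₂ a b,
      ThreeRoots a b c (Iio 0) (Iic 0) (Ioi 0)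
        {x | -√(-b) ≤ x ∧ x ≤ μ₂ a b}
        {x | μ₂ a b ≤ x ∧ x ≤ -c / b}
        {x | √(-b) ≤ x ∧ x ≤ ξ₂ a b}),
    (-c₂ a b < -c,
      OneRoot a b c (Ioi 0) {x | ξ₂ a b < x ∧ x < 1 + max |b| |c|}) ]

/-- The cases for `a = b = 0`. -/
def depressedZero (a b c : ℝ) : List (Prop × Prop) :=
  [ (-c < 0, OneRoot a b c (Iio 0) {realCbrt (-c)}),
    (-c = 0, ThreeRoots a b c {0} {0} {0} {0} {0} {0}),
    (-c > 0, OneRoot a b c (Ioi 0) {realCbrt (-c)}) ]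

/-- The cases for `a = 0`, `b > 0`. -/
def depressedPos (a b c : ℝ) : List (Prop × Prop) :=
  [ (-c ≤ 0,
      OneRoot a b c (Iic 0) {x | LtUnless (c = 0) (-c / b) x ∧ x ≤ 0}),
    (0 < -c,
      OneRoot a b c (Ioi 0) {x | 0 < x ∧ x < -c / b}) ]

/-- The cases for `b < -a² / 9`, `a < 0`. -/
def regime1Neg (a b c : ℝ) : List (Prop × Prop) :=
  [ (-c < -c₁ a b,
      OneRoot a b c (Iio 0) {x | -(1 + √(max |b| c)) < x ∧ x < ξ₁ a b}),
    (-c₁ a b ≤ -c ∧ -c < -(a * b),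
      ThreeRoots a b c (Iio 0) (Ioi 0) (Ioi 0)
        {x | ξ₁ a b ≤ x ∧ x < -√(-b)}
        {x | min (-a) √(-b) < x ∧ x ≤ μ₁ a b}
        {x | μ₁ a b ≤ x ∧ x < max (-a) √(-b)}),
    (-(a * b) ≤ -c ∧ -c < -c₀ a b,
      ThreeRoots a b c (Iio 0) (Ioi 0) (Ioi 0)
        {x | -√(-b) ≤ x ∧ x < ρ₂ a b}
        {x | ρ₀ a < x ∧ x ≤ min (-c / b) √(-b)}
        {x | max (-a) √(-b) ≤ x ∧ x < ρ₁ a b}),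
    (-c₀ a b ≤ -c ∧ -c < 0,
      ThreeRoots a b c (Iio 0) (Ioi 0) (Ioi 0)
        {x | ρ₂ a b ≤ x ∧ x < lam₂ a b}
        {x | 0 < x ∧ x ≤ min (-c / b) (ρ₀ a)}
        {x | ρ₁ a b ≤ x ∧ x < lam₁ a b}),
    (0 ≤ -c ∧ -c ≤ -c₂ a b,
      ThreeRoots a b c (Iio 0) (Iic 0) (Ioi 0)
        {x | lam₂ a b ≤ x ∧ x ≤ μ₂ a b}
        {x | μ₂ a b ≤ x ∧ x ≤ -c / b}
        {x | lam₁ a b ≤ x ∧ x ≤ ξ₂ a b}),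
    (-c₂ a b < -c,
      OneRoot a b c (Ioi 0) {x | ξ₂ a b < x ∧ x < 1 + max |a| (max |b| |c|)}) ]

/-- The cases for `b < -a² / 9`, `a > 0`. -/
def regime1Pos (a b c : ℝ) : List (Prop × Prop) :=
  [ (-c < -c₁ a b,
      OneRoot a b c (Iio 0) {x | -(1 + max a (max |b| c)) < x ∧ x < ξ₁ a b}),
    (-c₁ a b ≤ -c ∧ -c < 0,
      ThreeRoots a b c (Iio 0) (Ioi 0) (Ioi 0)
        {x | ξ₁ a b ≤ x ∧ x < lam₂ a b}
        {x | -c / b < x ∧ x ≤ μ₁ a b}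
        {x | μ₁ a b ≤ x ∧ x < lam₁ a b}),
    (0 ≤ -c ∧ -c < -c₀ a b,
      ThreeRoots a b c (Iio 0) (Iic 0) (Ioi 0)
        {x | lam₂ a b ≤ x ∧ x < ρ₂ a b}
        {x | LtUnless (c = 0) (-c / b) x ∧ ρ₀ a < x ∧ x ≤ 0}
        {x | lam₁ a b ≤ x ∧ x < ρ₁ a b}),
    (-c₀ a b ≤ -c ∧ -c < -(a * b),
      ThreeRoots a b c (Iio 0) (Iio 0) (Ioi 0)
        {x | ρ₂ a b ≤ x ∧ x < -a}
        {x | max (-c / b) (-√(-b)) < x ∧ x ≤ ρ₀ a}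
        {x | ρ₁ a b ≤ x ∧ x < √(-b)}),
    (-(a * b) ≤ -c ∧ -c ≤ -c₂ a b,
      ThreeRoots a b c (Iio 0) (Iio 0) (Ioi 0)
        {x | min (-a) (-√(-b)) ≤ x ∧ x ≤ μ₂ a b}
        {x | μ₂ a b ≤ x ∧ x ≤ max (-a) (-√(-b))}
        {x | √(-b) ≤ x ∧ x ≤ ξ₂ a b}),
    (-c₂ a b < -c,
      OneRoot a b c (Ioi 0) {x | ξ₂ a b < x ∧ x < 1 + √(max |b| |c|)}) ]

/-- The cases for `-a² / 9 ≤ b < 0`, `a < 0`. -/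
def regime2Neg (a b c : ℝ) : List (Prop × Prop) :=
  [ (-c < -c₁ a b,
      OneRoot a b c (Iio 0) {x | -(1 + √(max |b| c)) < x ∧ x < ξ₁ a b}),
    (-c₁ a b ≤ -c ∧ -c < -c₀ a b,
      ThreeRoots a b c (Iio 0) (Ioi 0) (Ioi 0)
        {x | ξ₁ a b ≤ x ∧ x < ρ₂ a b}
        {x | ρ₀ a < x ∧ x ≤ μ₁ a b}
        {x | μ₁ a b ≤ x ∧ x < ρ₁ a b}),
    (-c₀ a b ≤ -c ∧ -c < -(a * b),
      ThreeRoots a b c (Iio 0) (Ioi 0) (Ioi 0)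
        {x | ρ₂ a b ≤ x ∧ x < -√(-b)}
        {x | √(-b) < x ∧ x ≤ ρ₀ a}
        {x | ρ₁ a b ≤ x ∧ x < -a}),
    (-(a * b) ≤ -c ∧ -c < 0,
      ThreeRoots a b c (Iio 0) (Ioi 0) (Ioi 0)
        {x | -√(-b) ≤ x ∧ x < lam₂ a b}
        {x | 0 < x ∧ x ≤ min (-c / b) √(-b)}
        {x | -a ≤ x ∧ x < lam₁ a b}),
    (0 ≤ -c ∧ -c ≤ -c₂ a b,
      ThreeRoots a b c (Iio 0) (Iic 0) (Ioi 0)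
        {x | lam₂ a b ≤ x ∧ x ≤ μ₂ a b}
        {x | μ₂ a b ≤ x ∧ x ≤ -c / b}
        {x | lam₁ a b ≤ x ∧ x ≤ ξ₂ a b}),
    (-c₂ a b < -c,
      OneRoot a b c (Ioi 0) {x | ξ₂ a b < x ∧ x < 1 + max |a| (max |b| |c|)}) ]

/-- The cases for `-a² / 9 ≤ b < 0`, `a > 0`. -/
def regime2Pos (a b c : ℝ) : List (Prop × Prop) :=
  [ (-c < -c₁ a b,
      OneRoot a b c (Iio 0) {x | -(1 + max a (max |b| c)) < x ∧ x < ξ₁ a b}),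
    (-c₁ a b ≤ -c ∧ -c < 0,
      ThreeRoots a b c (Iio 0) (Ioi 0) (Ioi 0)
        {x | ξ₁ a b ≤ x ∧ x < lam₂ a b}
        {x | -c / b < x ∧ x ≤ μ₁ a b}
        {x | μ₁ a b ≤ x ∧ x < lam₁ a b}),
    (0 ≤ -c ∧ -c < -(a * b),
      ThreeRoots a b c (Iio 0) (Iic 0) (Ioi 0)
        {x | lam₂ a b ≤ x ∧ x < -a}
        {x | LtUnless (c = 0) (-c / b) x ∧ -√(-b) < x ∧ x ≤ 0}
        {x | lam₁ a b ≤ x ∧ x < √(-b)}),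
    (-(a * b) ≤ -c ∧ -c < -c₀ a b,
      ThreeRoots a b c (Iio 0) (Iio 0) (Ioi 0)
        {x | -a ≤ x ∧ x < ρ₂ a b}
        {x | ρ₀ a < x ∧ x ≤ -√(-b)}
        {x | √(-b) ≤ x ∧ x < ρ₁ a b}),
    (-c₀ a b ≤ -c ∧ -c ≤ -c₂ a b,
      ThreeRoots a b c (Iio 0) (Iio 0) (Ioi 0)
        {x | ρ₂ a b ≤ x ∧ x ≤ μ₂ a b}
        {x | μ₂ a b ≤ x ∧ x ≤ ρ₀ a}
        {x | ρ₁ a b ≤ x ∧ x ≤ ξ₂ a b}),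
    (-c₂ a b < -c,
      OneRoot a b c (Ioi 0) {x | ξ₂ a b < x ∧ x < 1 + √(max |b| |c|)}) ]

/-- The cases for `b = 0`, `a < 0`. -/
def regime3Neg (a b c : ℝ) : List (Prop × Prop) :=
  [ (-c < -c₁ a b,
      OneRoot a b c (Iio 0) {x | -(max 1 c) < x ∧ x < ξ₁ a b}),
    (-c₁ a b ≤ -c ∧ -c < -c₀ a b,
      ThreeRoots a b c (Iio 0) (Ioi 0) (Ioi 0)
        {x | ξ₁ a b ≤ x ∧ x < ρ₂ a b}
        {x | ρ₀ a < x ∧ x ≤ μ₁ a b}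
        {x | μ₁ a b ≤ x ∧ x < ρ₁ a b}),
    (-c₀ a b ≤ -c ∧ -c ≤ 0,
      ThreeRoots a b c (Iic 0) (Ici 0) (Ioi 0)
        {x | ρ₂ a b ≤ x ∧ LtUnless (c = 0) x 0}
        {x | LtUnless (c = 0) 0 x ∧ x ≤ ρ₀ a}
        {x | ρ₁ a b ≤ x ∧ LtUnless (c = 0) x (-a)}),
    (0 < -c,
      OneRoot a b c (Ioi 0) {x | -a < x ∧ x < 1 + max |a| |c|}) ]

/-- The cases for `b = 0`, `a > 0`. -/
def regime3Pos (a b c : ℝ) : List (Prop × Prop) :=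
  [ (-c < 0,
      OneRoot a b c (Iio 0) {x | -(1 + max a |c|) < x ∧ x < -a}),
    (0 ≤ -c ∧ -c < -c₀ a b,
      ThreeRoots a b c (Iio 0) (Iic 0) {x | LtUnless (c = 0) 0 x}
        {x | -a ≤ x ∧ x < ρ₂ a b}
        {x | ρ₀ a < x ∧ x ≤ 0}
        {x | 0 ≤ x ∧ x < ρ₁ a b}),
    (-c₀ a b ≤ -c ∧ -c ≤ -c₂ a b,
      ThreeRoots a b c (Iio 0) (Iio 0) (Ioi 0)
        {x | ρ₂ a b ≤ x ∧ LtUnless (c = c₂ a b) x (μ₂ a b)}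
        {x | LtUnless (c = c₂ a b) (μ₂ a b) x ∧ x ≤ ρ₀ a}
        {x | ρ₁ a b ≤ x ∧ LtUnless (c = c₂ a b) x (ξ₂ a b)}),
    (-c₂ a b < -c,
      OneRoot a b c (Ioi 0) {x | ξ₂ a b ≤ x ∧ x < max 1 |c|}) ]

/-- The cases for `0 < b ≤ 2a² / 9`, `a < 0`. -/
def regime4Neg (a b c : ℝ) : List (Prop × Prop) :=
  [ (-c < -c₁ a b,
      OneRoot a b c (Iio 0) {x | -c / b < x ∧ x < ξ₁ a b}),
    (-c₁ a b ≤ -c ∧ -c < -c₀ a b,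
      ThreeRoots a b c (Iio 0) (Ioi 0) (Ioi 0)
        {x | max (-c / b) (ξ₁ a b) ≤ x ∧ x < ρ₂ a b}
        {x | ρ₀ a < x ∧ x ≤ μ₁ a b}
        {x | μ₁ a b ≤ x ∧ x < ρ₁ a b}),
    (-c₀ a b ≤ -c ∧ -c < 0,
      ThreeRoots a b c (Iio 0) (Ioi 0) (Ioi 0)
        {x | max (-c / b) (ρ₂ a b) ≤ x ∧ x < 0}
        {x | lam₂ a b < x ∧ x ≤ ρ₀ a}
        {x | ρ₁ a b ≤ x ∧ x < lam₁ a b}),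
    (0 ≤ -c ∧ -c ≤ -c₂ a b,
      ThreeRoots a b c (Ici 0) (Ioi 0) (Ioi 0)
        {x | -c / b ≤ x ∧ x ≤ μ₂ a b}
        {x | μ₂ a b ≤ x ∧ x ≤ lam₂ a b}
        {x | lam₁ a b ≤ x ∧ x ≤ ξ₂ a b}),
    (-c₂ a b < -c ∧ -c < -(a * b),
      OneRoot a b c (Ioi 0) {x | max (-c / b) (ξ₂ a b) < x ∧ x < -a}),
    (-(a * b) ≤ -c,
      OneRoot a b c (Ioi 0) {x | -a ≤ x ∧ LtUnless (c = a * b) x (-c / b)}) ]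

/-- The cases for `0 < b ≤ 2a² / 9`, `a > 0`. -/
def regime4Pos (a b c : ℝ) : List (Prop × Prop) :=
  [ (-c < -(a * b),
      OneRoot a b c (Iio 0) {x | -c / b < x ∧ x < -a}),
    (-(a * b) ≤ -c ∧ -c < -c₁ a b,
      OneRoot a b c (Iio 0) {x | -a ≤ x ∧ LtUnless (c = a * b) x (-c / b) ∧ x < ξ₁ a b}),
    (-c₁ a b ≤ -c ∧ -c < 0,
      ThreeRoots a b c (Iio 0) (Iio 0) (Iio 0)
        {x | ξ₁ a b ≤ x ∧ x < lam₂ a b}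
        {x | lam₁ a b < x ∧ x ≤ μ₁ a b}
        {x | μ₁ a b ≤ x ∧ x < -c / b}),
    (0 ≤ -c ∧ -c < -c₀ a b,
      ThreeRoots a b c (Iio 0) (Iio 0) (Ici 0)
        {x | lam₂ a b ≤ x ∧ x < ρ₂ a b}
        {x | ρ₀ a < x ∧ x ≤ lam₁ a b}
        {x | 0 ≤ x ∧ LtUnless (c = 0) x (-c / b) ∧ x < ρ₁ a b}),
    (-c₀ a b ≤ -c ∧ -c ≤ -c₂ a b,
      ThreeRoots a b c (Iio 0) (Iio 0) {x | LtUnless (c = 0) 0 x}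
        {x | ρ₂ a b ≤ x ∧ x ≤ μ₂ a b}
        {x | μ₂ a b ≤ x ∧ x ≤ ρ₀ a}
        {x | ρ₁ a b ≤ x ∧ x ≤ min (-c / b) (ξ₂ a b)}),
    (-c₂ a b < -c,
      OneRoot a b c (Ioi 0) {x | ξ₂ a b < x ∧ x < -c / b}) ]

/-- The cases for `2a² / 9 < b ≤ a² / 4`, `a < 0`. -/
def regime5Neg (a b c : ℝ) : List (Prop × Prop) :=
  [ (-c < -c₁ a b,
      OneRoot a b c (Iio 0) {x | -c / b < x ∧ x < ξ₁ a b}),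
    (-c₁ a b ≤ -c ∧ -c < 0,
      ThreeRoots a b c (Iio 0) (Ioi 0) (Ioi 0)
        {x | max (-c / b) (ξ₁ a b) ≤ x ∧ x < 0}
        {x | lam₂ a b < x ∧ x ≤ μ₁ a b}
        {x | μ₁ a b ≤ x ∧ x < lam₁ a b}),
    (0 ≤ -c ∧ -c < -c₀ a b,
      ThreeRoots a b c (Ici 0) (Ioi 0) (Ioi 0)
        {x | -c / b ≤ x ∧ x < ρ₂ a b}
        {x | ρ₀ a < x ∧ x ≤ lam₂ a b}
        {x | lam₁ a b ≤ x ∧ x < ρ₁ a b}),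
    (-c₀ a b ≤ -c ∧ -c ≤ -c₂ a b,
      ThreeRoots a b c (Ioi 0) (Ioi 0) (Ioi 0)
        {x | max (ρ₂ a b) (-c / b) ≤ x ∧ x ≤ μ₂ a b}
        {x | μ₂ a b ≤ x ∧ x ≤ ρ₀ a}
        {x | ρ₁ a b ≤ x ∧ x ≤ ξ₂ a b}),
    (-c₂ a b < -c ∧ -c ≤ -(a * b),
      OneRoot a b c (Ioi 0) {x | LtUnless (c = a * b) (-c / b) x ∧ ξ₂ a b < x ∧ x ≤ -a}),
    (-(a * b) < -c,
      OneRoot a b c (Ioi 0) {x | -a < x ∧ x < -c / b}) ]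

/-- The cases for `2a² / 9 < b ≤ a² / 4`, `a > 0`. -/
def regime5Pos (a b c : ℝ) : List (Prop × Prop) :=
  [ (-c < -(a * b),
      OneRoot a b c (Iio 0) {x | -c / b < x ∧ x < -a}),
    (-(a * b) ≤ -c ∧ -c < -c₁ a b,
      OneRoot a b c (Iio 0) {x | -a ≤ x ∧ LtUnless (c = a * b) x (-c / b) ∧ x < ξ₁ a b}),
    (-c₁ a b ≤ -c ∧ -c < -c₀ a b,
      ThreeRoots a b c (Iio 0) (Iio 0) (Iio 0)
        {x | ξ₁ a b ≤ x ∧ x < ρ₂ a b}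
        {x | ρ₀ a < x ∧ x ≤ μ₁ a b}
        {x | μ₁ a b ≤ x ∧ x < min (-c / b) (ρ₁ a b)}),
    (-c₀ a b ≤ -c ∧ -c < 0,
      ThreeRoots a b c (Iio 0) (Iio 0) (Iio 0)
        {x | ρ₂ a b ≤ x ∧ x < lam₂ a b}
        {x | lam₁ a b < x ∧ x ≤ ρ₀ a}
        {x | ρ₁ a b ≤ x ∧ x < -c / b}),
    (0 ≤ -c ∧ -c ≤ -c₂ a b,
      ThreeRoots a b c (Iio 0) (Iio 0) (Ici 0)
        {x | lam₂ a b ≤ x ∧ x ≤ μ₂ a b}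
        {x | μ₂ a b ≤ x ∧ x ≤ lam₁ a b}
        {x | 0 ≤ x ∧ x ≤ min (-c / b) (ξ₂ a b)}),
    (-c₂ a b < -c,
      OneRoot a b c (Ioi 0) {x | ξ₂ a b < x ∧ x < -c / b}) ]

/-- The cases for `a² / 4 < b ≤ a² / 3`, `a < 0`. -/
def regime6Neg (a b c : ℝ) : List (Prop × Prop) :=
  [ (-c < 0,
      OneRoot a b c (Iio 0) {x | -c / b < x ∧ x < 0}),
    (0 ≤ -c ∧ -c < -c₁ a b,
      OneRoot a b c (Ici 0) {x | -c / b ≤ x ∧ x < ξ₁ a b}),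
    (-c₁ a b ≤ -c ∧ -c < -c₀ a b,
      ThreeRoots a b c (Ioi 0) (Ioi 0) (Ioi 0)
        {x | max (-c / b) (ξ₁ a b) ≤ x ∧ x < ρ₂ a b}
        {x | ρ₀ a < x ∧ x ≤ μ₁ a b}
        {x | μ₁ a b ≤ x ∧ x < ρ₁ a b}),
    (-c₀ a b ≤ -c ∧ -c ≤ -c₂ a b,
      ThreeRoots a b c (Ioi 0) (Ioi 0) (Ioi 0)
        {x | max (-c / b) (ρ₂ a b) ≤ x ∧ x ≤ μ₂ a b}
        {x | μ₂ a b ≤ x ∧ x ≤ ρ₀ a}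
        {x | ρ₁ a b ≤ x ∧ x ≤ ξ₂ a b}),
    (-c₂ a b < -c ∧ -c ≤ -(a * b),
      OneRoot a b c (Ioi 0) {x | LtUnless (c = a * b) (-c / b) x ∧ ξ₂ a b < x ∧ x ≤ -a}),
    (-(a * b) < -c,
      OneRoot a b c (Ioi 0) {x | -a < x ∧ x < -c / b}) ]

/-- The cases for `a² / 4 < b ≤ a² / 3`, `a > 0`. -/
def regime6Pos (a b c : ℝ) : List (Prop × Prop) :=
  [ (-c < -(a * b),
      OneRoot a b c (Iio 0) {x | -c / b < x ∧ x < -a}),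
    (-(a * b) ≤ -c ∧ -c < -c₁ a b,
      OneRoot a b c (Iio 0) {x | -a ≤ x ∧ LtUnless (c = a * b) x (-c / b) ∧ x < ξ₁ a b}),
    (-c₁ a b ≤ -c ∧ -c < -c₀ a b,
      ThreeRoots a b c (Iio 0) (Iio 0) (Iio 0)
        {x | ξ₁ a b ≤ x ∧ x < ρ₂ a b}
        {x | ρ₀ a < x ∧ x ≤ μ₁ a b}
        {x | μ₁ a b ≤ x ∧ x < min (-c / b) (ρ₁ a b)}),
    (-c₀ a b ≤ -c ∧ -c ≤ -c₂ a b,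
      ThreeRoots a b c (Iio 0) (Iio 0) (Iio 0)
        {x | ρ₂ a b ≤ x ∧ x ≤ μ₂ a b}
        {x | μ₂ a b ≤ x ∧ x ≤ ρ₀ a}
        {x | ρ₁ a b ≤ x ∧ x < -c / b ∧ LtUnless (c = c₂ a b) x (ξ₂ a b)}),
    (-c₂ a b < -c ∧ -c ≤ 0,
      OneRoot a b c (Iic 0) {x | ξ₂ a b < x ∧ x ≤ -c / b}),
    (0 < -c,
      OneRoot a b c (Ioi 0) {x | 0 < x ∧ x < -c / b}) ]

/-- The cases for `b > a² / 3`, `a < 0`. -/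
def regime7Neg (a b c : ℝ) : List (Prop × Prop) :=
  [ (-c < 0,
      OneRoot a b c (Iio 0) {x | -c / b < x ∧ x < 0}),
    (0 ≤ -c ∧ -c < -c₀ a b,
      OneRoot a b c (Ici 0) {x | -c / b ≤ x ∧ x < ρ₀ a}),
    (-c₀ a b ≤ -c ∧ -c < -(a * b),
      OneRoot a b c (Ioi 0) {x | max (-c / b) (ρ₀ a) ≤ x ∧ x < -a}),
    (-(a * b) ≤ -c,
      OneRoot a b c (Ioi 0) {x | -a ≤ x ∧ LtUnless (c = a * b) x (-c / b)}) ]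

/-- The cases for `b > a² / 3`, `a > 0`. -/
def regime7Pos (a b c : ℝ) : List (Prop × Prop) :=
  [ (-c < -(a * b),
      OneRoot a b c (Iio 0) {x | -c / b < x ∧ x < -a}),
    (-(a * b) ≤ -c ∧ -c < -c₀ a b,
      OneRoot a b c (Iio 0) {x | -a ≤ x ∧ LtUnless (c = a * b) x (-c / b) ∧ x < ρ₀ a}),
    (-c₀ a b ≤ -c ∧ -c < 0,
      OneRoot a b c (Iio 0) {x | ρ₀ a ≤ x ∧ x < -c / b}),
    (0 ≤ -c,
      OneRoot a b c (Ici 0) {x | 0 ≤ x ∧ LtUnless (c = 0) x (-c / b)}) ]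

/-- The explicit values of the endpoints for `a = 0`, `b < 0`. -/
def depressedNegValues (a b : ℝ) : Prop :=
  c₁ a b = (2 * √3 / 9) * √(-b ^ 3) ∧ c₂ a b = -((2 * √3 / 9) * √(-b ^ 3)) ∧
  μ₁ a b = (√3 / 3) * √(-b) ∧ μ₂ a b = -((√3 / 3) * √(-b)) ∧
  ξ₁ a b = -((2 * √3 / 3) * √(-b)) ∧ ξ₂ a b = (2 * √3 / 3) * √(-b)

/-- The explicit values of the endpoints for `b = 0`, `a < 0`. -/
def regime3NegValues (a b : ℝ) : Prop :=
  -c₁ a b = (4 / 27) * a ^ 3 ∧ -c₀ a b = (2 / 27) * a ^ 3 ∧ c₂ a b = 0 ∧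
  ξ₁ a b = (1 / 3) * a ∧ μ₁ a b = -(2 / 3) * a ∧ ρ₀ a = -(1 / 3) * a ∧
  ρ₁ a b = (-1 - √3) * a / 3 ∧ ρ₂ a b = (-1 + √3) * a / 3

/-- The explicit values of the endpoints for `b = 0`, `a > 0`. -/
def regime3PosValues (a b : ℝ) : Prop :=
  c₁ a b = 0 ∧ -c₀ a b = (2 / 27) * a ^ 3 ∧ -c₂ a b = (4 / 27) * a ^ 3 ∧
  ξ₂ a b = (1 / 3) * a ∧ μ₂ a b = -(2 / 3) * a ∧ ρ₀ a = -(1 / 3) * a ∧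
  ρ₁ a b = (-1 + √3) * a / 3 ∧ ρ₂ a b = (-1 - √3) * a / 3

end MonicCubic

end

open Set Polynomial

noncomputable section

namespace MonicCubic

/-! Fix a and b and let c vary: the roots are the abscissae where the fixed graph of x³ + ax² + bx
meets the horizontal line at height −c. For b ≤ a²/3 this graph has critical points μ₂ ≤ μ₁ and
three monotone branches. All roots are real exactly for c₂ ≤ c ≤ c₁ (`Split.le_c₁`, `Split.c₂_le`,
`exists_split`), with one root on each branch (`Split.interlace`), and lowering c pushes the outer
roots up and the middle one down (`Split.le`, `Split.lt`).

Apart from the bounds by −c/b and the a priori bounds, the interval endpoints are roots of a cubic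
with the same a, b and a special free term for which it factors: c₁ and c₂ (a double root), c₀
(symmetry about −a/3), 0 (a factor x) and ab (the factor x + a). Placing c between two such values
therefore places each root between corresponding landmark roots; this is `Split.of_between`. The
ranges of (a, b) record how the special values are ordered, which is governed by 27c₀ = a(9b − 2a²),
27(ab − c₀) = 2a(a² + 9b), and the signs of a, b and b − a²/4.

Outside [c₂, c₁], and for every c when b > a²/3, the discriminant is negative and only one real root
remains (`exists_single`). The sign of the cubic at a point then tells on which side the root lies,
so the same landmarks locate it. The bounds by −c/b come from bx + c = −x²(x + a), and the a priori
bounds from evaluating the cubic at a large point. A displayed interval contains no second root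
because any root in it must lie on a single monotone branch (`Split.threeRoots`). -/

/-- The reals `x₃ ≤ x₂ ≤ x₁` are the roots, with multiplicity, of `x³ + a x² + b x + c`. -/
structure Split (a b c x₃ x₂ x₁ : ℝ) : Prop where
  le₃₂ : x₃ ≤ x₂
  le₂₁ : x₂ ≤ x₁
  sum : a = -(x₁ + x₂ + x₃)
  pairs : b = x₁ * x₂ + x₁ * x₃ + x₂ * x₃
  prod : c = -(x₁ * x₂ * x₃)

/-- `x` is a zero of `x³ + a x² + b x + c`. -/
def IsZero (a b c x : ℝ) : Prop := x ^ 3 + a * x ^ 2 + b * x + c = 0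

theorem mem_roots_cubic {a b c y : ℝ} (hy : y ∈ (cubic a b c).roots) : IsZero a b c y := by
  have h := (mem_roots'.1 hy).2
  simpa [cubic, IsRoot, IsZero] using h

/-- This upgrades weak comparisons of roots to strict ones when the free terms differ. -/
theorem IsZero.unique {a b c c' x : ℝ} (h : IsZero a b c x) (h' : IsZero a b c' x) : c = c' := by
  unfold IsZero at h h'; linarith

theorem isZero_zero (a b : ℝ) : IsZero a b 0 0 := by simp [IsZero]

theorem isZero_neg (a b : ℝ) : IsZero a b (a * b) (-a) := by unfold IsZero; ring

theorem isZero_ρ₀ (a b : ℝ) : IsZero a b (c₀ a b) (ρ₀ a) := by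
  unfold IsZero c₀ ρ₀; ring

/-! ### Half the distance of the critical points -/

/-- Half the distance of the two critical points. -/
def halfGap (a b : ℝ) : ℝ := (√3 / 3) * √(a ^ 2 / 3 - b)

theorem halfGap_nonneg (a b : ℝ) : 0 ≤ halfGap a b := by unfold halfGap; positivity

theorem sq_halfGap {a b : ℝ} (h : b ≤ a ^ 2 / 3) : halfGap a b ^ 2 = (a ^ 2 / 3 - b) / 3 := by
  unfold halfGap
  rw [mul_pow, div_pow, Real.sq_sqrt (by norm_num), Real.sq_sqrt (by linarith)]
  ring

theorem μ₁_eq (a b : ℝ) : μ₁ a b = -a / 3 + halfGap a b := rfl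

theorem μ₂_eq (a b : ℝ) : μ₂ a b = -a / 3 - halfGap a b := rfl

theorem ξ₁_eq (a b : ℝ) : ξ₁ a b = -a / 3 - 2 * halfGap a b := by
  unfold ξ₁ halfGap; ring

theorem ξ₂_eq (a b : ℝ) : ξ₂ a b = -a / 3 + 2 * halfGap a b := by
  unfold ξ₂ halfGap; ring

/-- With u half the critical gap, a² − 3b = 9u², so the radicand is a perfect square. This turns c₁
and c₂ into c₀ ± 2u³ and makes later identities polynomial. -/
theorem sqrt_cube_eq {a b : ℝ} (h : b ≤ a ^ 2 / 3) :
    √((a ^ 2 - 3 * b) ^ 3) = 27 * halfGap a b ^ 3 := by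
  have h2 : a ^ 2 - 3 * b = 9 * halfGap a b ^ 2 := by rw [sq_halfGap h]; ring
  rw [h2, show (9 * halfGap a b ^ 2) ^ 3 = (27 * halfGap a b ^ 3) ^ 2 by ring,
    Real.sqrt_sq (by have := halfGap_nonneg a b; positivity)]

theorem c₁_eq {a b : ℝ} (h : b ≤ a ^ 2 / 3) : c₁ a b = c₀ a b + 2 * halfGap a b ^ 3 := by
  unfold c₁; rw [sqrt_cube_eq h]; ring

theorem c₂_eq {a b : ℝ} (h : b ≤ a ^ 2 / 3) : c₂ a b = c₀ a b - 2 * halfGap a b ^ 3 := by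
  unfold c₂; rw [sqrt_cube_eq h]; ring

/-! ### Split cubics -/

namespace Split

variable {a b c c' x₃ x₂ x₁ y₃ y₂ y₁ : ℝ}

theorem factor (h : Split a b c x₃ x₂ x₁) (e : ℝ) :
    e ^ 3 + a * e ^ 2 + b * e + c = (e - x₁) * (e - x₂) * (e - x₃) := by
  rw [h.sum, h.pairs, h.prod]; ring

theorem isZero₃ (h : Split a b c x₃ x₂ x₁) : IsZero a b c x₃ := by
  unfold IsZero; rw [h.factor]; ring

theorem isZero₂ (h : Split a b c x₃ x₂ x₁) : IsZero a b c x₂ := by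
  unfold IsZero; rw [h.factor]; ring

theorem isZero₁ (h : Split a b c x₃ x₂ x₁) : IsZero a b c x₁ := by
  unfold IsZero; rw [h.factor]; ring

theorem roots (h : Split a b c x₃ x₂ x₁) : (cubic a b c).roots = {x₃, x₂, x₁} := by
  have : cubic a b c = (({x₃, x₂, x₁} : Multiset ℝ).map fun x => X - C x).prod := by
    unfold cubic
    rw [h.sum, h.pairs, h.prod]
    simp
    ring
  rw [this, roots_multiset_prod_X_sub_C]

theorem le_sq_div_three (h : Split a b c x₃ x₂ x₁) : b ≤ a ^ 2 / 3 := by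
  rw [h.sum, h.pairs]
  nlinarith [sq_nonneg (x₁ - x₂), sq_nonneg (x₁ - x₃), sq_nonneg (x₂ - x₃)]

/-- The critical points separate the roots. -/
theorem interlace (h : Split a b c x₃ x₂ x₁) :
    x₃ ≤ μ₂ a b ∧ μ₂ a b ≤ x₂ ∧ x₂ ≤ μ₁ a b ∧ μ₁ a b ≤ x₁ := by
  have hs := sq_halfGap h.le_sq_div_three
  have h0 := halfGap_nonneg a b
  rw [μ₁_eq, μ₂_eq]
  set u := halfGap a b
  have h32 := sub_nonneg.2 h.le₃₂
  have h21 := sub_nonneg.2 h.le₂₁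
  -- The derivative at x is 3((x + a/3)² − u²). At a root it is also the product of the differences
  -- to the other two roots; equating the two gives these three identities.
  have e3 : (-a / 3 - x₃) ^ 2 = u ^ 2 + (x₁ - x₃) * (x₂ - x₃) / 3 := by
    rw [hs, h.sum, h.pairs]; ring
  have e2 : (x₂ - -a / 3) ^ 2 = u ^ 2 - (x₁ - x₂) * (x₂ - x₃) / 3 := by
    rw [hs, h.sum, h.pairs]; ring
  have e1 : (x₁ - -a / 3) ^ 2 = u ^ 2 + (x₁ - x₂) * (x₁ - x₃) / 3 := by
    rw [hs, h.sum, h.pairs]; ring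
  have p1 : 0 ≤ (x₁ - x₃) * (x₂ - x₃) := mul_nonneg (by linarith) h32
  have p2 : 0 ≤ (x₁ - x₂) * (x₂ - x₃) := mul_nonneg h21 h32
  have p3 : 0 ≤ (x₁ - x₂) * (x₁ - x₃) := mul_nonneg h21 (by linarith)
  -- The point −a/3 is the mean of the roots, hence lies between the outer ones; this fixes the
  -- signs when square roots are taken.
  have m : -a / 3 = (x₁ + x₂ + x₃) / 3 := by rw [h.sum]; ring
  have q3 : u ≤ -a / 3 - x₃ := abs_le_of_sq_le_sq' (by linarith) (by linarith) |>.2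
  have q1 : u ≤ x₁ - -a / 3 := abs_le_of_sq_le_sq' (by linarith) (by linarith) |>.2
  have q2 := abs_le_of_sq_le_sq' (show (x₂ - -a / 3) ^ 2 ≤ u ^ 2 by linarith) h0
  exact ⟨by linarith, by linarith [q2.1], by linarith [q2.2], by linarith⟩

/-- The value of the cubic at μ₁ is c − c₁, and it is nonpositive because μ₁ lies between x₂ and x₁.
The next lemma is the mirror image at μ₂. -/
theorem le_c₁ (h : Split a b c x₃ x₂ x₁) : c ≤ c₁ a b := by
  obtain ⟨i1, i2, i3, i4⟩ := h.interlace
  have hb := h.le_sq_div_three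
  have hs := sq_halfGap hb
  have hf := h.factor (μ₁ a b)
  have : 0 ≤ (x₁ - μ₁ a b) * (μ₁ a b - x₂) * (μ₁ a b - x₃) :=
    mul_nonneg (mul_nonneg (by linarith) (by linarith)) (by linarith)
  have e : μ₁ a b ^ 3 + a * μ₁ a b ^ 2 + b * μ₁ a b + c = c - c₁ a b := by
    rw [c₁_eq hb, μ₁_eq, c₀]
    linear_combination (3 * halfGap a b) * hs
  linarith

theorem c₂_le (h : Split a b c x₃ x₂ x₁) : c₂ a b ≤ c := by
  obtain ⟨i1, i2, i3, i4⟩ := h.interlace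
  have hb := h.le_sq_div_three
  have hs := sq_halfGap hb
  have hf := h.factor (μ₂ a b)
  have : 0 ≤ (x₁ - μ₂ a b) * (x₂ - μ₂ a b) * (μ₂ a b - x₃) :=
    mul_nonneg (mul_nonneg (by linarith) (by linarith)) (by linarith)
  have e : μ₂ a b ^ 3 + a * μ₂ a b ^ 2 + b * μ₂ a b + c = c - c₂ a b := by
    rw [c₂_eq hb, μ₂_eq, c₀]
    linear_combination (-3 * halfGap a b) * hs
  linarith

end Split

/-! ### Monotone branches and dependence of the roots on the free term -/

/-- On the left of both critical points the cubic increases. -/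
theorem le_of_le_μ₂ {a b c c' x y : ℝ} (hb : b ≤ a ^ 2 / 3) (hx : IsZero a b c x)
    (hy : IsZero a b c' y) (hyμ : y ≤ μ₂ a b) (hc : c ≤ c') : y ≤ x := by
  unfold IsZero at hx hy
  have hs := sq_halfGap hb
  have h0 := halfGap_nonneg a b
  rw [μ₂_eq] at hyμ
  set u := halfGap a b
  by_contra! hxy
  have p1 : 0 ≤ (y - x) * ((-a / 3 - u - x) * (-a / 3 - u - y)) :=
    mul_nonneg (by linarith) (mul_nonneg (by linarith) (by linarith))
  have p2 : 0 < (y - x) * (y - x) ^ 2 := mul_pos (by linarith) (pow_pos (by linarith) 2)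
  have p3 : 0 ≤ (y - x) * (u * (-a / 3 - u - x + (-a / 3 - u - y))) :=
    mul_nonneg (by linarith) (mul_nonneg h0 (by linarith))
  -- The difference quotient v² + vw + w² − 3u² in coordinates centred at −a/3, rewritten through
  -- the distances of x and y to the critical point −a/3 − u; every summand is then visibly
  -- nonnegative.
  have e : c - c' = (y - x) * (y - x) ^ 2 +
      3 * ((y - x) * ((-a / 3 - u - x) * (-a / 3 - u - y))) +
      3 * ((y - x) * (u * (-a / 3 - u - x + (-a / 3 - u - y)))) := by
    linear_combination hx - hy + (3 * (y - x)) * hs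
  linarith

/-- On the right of both critical points the cubic increases. -/
theorem le_of_μ₁_le {a b c c' x y : ℝ} (hb : b ≤ a ^ 2 / 3) (hx : IsZero a b c x)
    (hy : IsZero a b c' y) (hxμ : μ₁ a b ≤ x) (hc : c ≤ c') : y ≤ x := by
  unfold IsZero at hx hy
  have hs := sq_halfGap hb
  have h0 := halfGap_nonneg a b
  rw [μ₁_eq] at hxμ
  set u := halfGap a b
  by_contra! hxy
  have p1 : 0 ≤ (y - x) * ((x - (-a / 3 + u)) * (y - (-a / 3 + u))) :=
    mul_nonneg (by linarith) (mul_nonneg (by linarith) (by linarith))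
  have p2 : 0 < (y - x) * (y - x) ^ 2 := mul_pos (by linarith) (pow_pos (by linarith) 2)
  have p3 : 0 ≤ (y - x) * (u * (x - (-a / 3 + u) + (y - (-a / 3 + u)))) :=
    mul_nonneg (by linarith) (mul_nonneg h0 (by linarith))
  have e : c - c' = (y - x) * (y - x) ^ 2 +
      3 * ((y - x) * ((x - (-a / 3 + u)) * (y - (-a / 3 + u)))) +
      3 * ((y - x) * (u * (x - (-a / 3 + u) + (y - (-a / 3 + u))))) := by
    linear_combination hx - hy + (3 * (y - x)) * hs
  linarith

/-- Between the critical points the cubic decreases. -/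
theorem le_of_mem_Icc {a b c c' x y : ℝ} (hb : b ≤ a ^ 2 / 3) (hx : IsZero a b c x)
    (hy : IsZero a b c' y) (hxμ : x ∈ Icc (μ₂ a b) (μ₁ a b)) (hyμ : y ∈ Icc (μ₂ a b) (μ₁ a b))
    (hc : c ≤ c') : x ≤ y := by
  unfold IsZero at hx hy
  have hs := sq_halfGap hb
  have h0 := halfGap_nonneg a b
  rw [μ₁_eq, μ₂_eq] at hxμ hyμ
  obtain ⟨hx1, hx2⟩ := hxμ
  obtain ⟨hy1, hy2⟩ := hyμ
  set u := halfGap a b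
  by_contra! hxy
  obtain ⟨v, rfl⟩ : ∃ v, x = -a / 3 + v := ⟨x + a / 3, by ring⟩
  obtain ⟨w, rfl⟩ : ∃ w, y = -a / 3 + w := ⟨y + a / 3, by ring⟩
  -- v² + vw + w² = (3/2)(v² + w²) − (v − w)²/2, with v², w² ≤ u² and v ≠ w.
  have q : v ^ 2 + v * w + w ^ 2 < 3 * u ^ 2 := by
    nlinarith [mul_nonneg (show 0 ≤ u - v by linarith) (show 0 ≤ u + v by linarith),
      mul_nonneg (show 0 ≤ u - w by linarith) (show 0 ≤ u + w by linarith),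
      pow_pos (show 0 < v - w by linarith) 2]
  have p1 : 0 < (v - w) * (3 * u ^ 2 - (v ^ 2 + v * w + w ^ 2)) :=
    mul_pos (by linarith) (by linarith)
  have e : c - c' = (v - w) * (3 * u ^ 2 - (v ^ 2 + v * w + w ^ 2)) := by
    linear_combination hx - hy - (3 * (v - w)) * hs
  linarith

namespace Split

variable {a b c c' x₃ x₂ x₁ y₃ y₂ y₁ : ℝ}

/-- Lowering the free term moves the outer roots up and the middle root down. -/
theorem le (h : Split a b c x₃ x₂ x₁) (h' : Split a b c' y₃ y₂ y₁) (hc : c ≤ c') :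
    y₃ ≤ x₃ ∧ x₂ ≤ y₂ ∧ y₁ ≤ x₁ := by
  obtain ⟨i1, i2, i3, i4⟩ := h.interlace
  obtain ⟨j1, j2, j3, j4⟩ := h'.interlace
  have hb := h.le_sq_div_three
  exact ⟨le_of_le_μ₂ hb h.isZero₃ h'.isZero₃ j1 hc,
    le_of_mem_Icc hb h.isZero₂ h'.isZero₂ ⟨i2, i3⟩ ⟨j2, j3⟩ hc,
    le_of_μ₁_le hb h.isZero₁ h'.isZero₁ i4 hc⟩

theorem lt (h : Split a b c x₃ x₂ x₁) (h' : Split a b c' y₃ y₂ y₁) (hc : c < c') :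
    y₃ < x₃ ∧ x₂ < y₂ ∧ y₁ < x₁ := by
  obtain ⟨l3, l2, l1⟩ := h.le h' hc.le
  refine ⟨l3.lt_of_ne ?_, l2.lt_of_ne ?_, l1.lt_of_ne ?_⟩
  · rintro rfl
    exact hc.ne (h.isZero₃.unique h'.isZero₃)
  · rintro rfl
    exact hc.ne (h.isZero₂.unique h'.isZero₂)
  · rintro rfl
    exact hc.ne (h.isZero₁.unique h'.isZero₁)

/-- The cubic is injective on each monotone branch, so uniqueness only requires that a root in the
given interval be on the right branch. The hypotheses ask this of roots alone, since an interval
bounded by −c/b need not lie in the branch as a set. -/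
theorem threeRoots {S₃ S₂ S₁ : Set ℝ} {p₃ p₂ p₁ : ℝ → Prop} (h : Split a b c x₃ x₂ x₁)
    (s : x₃ ∈ S₃ ∧ x₂ ∈ S₂ ∧ x₁ ∈ S₁) (i : p₃ x₃ ∧ p₂ x₂ ∧ p₁ x₁)
    (u₃ : ∀ y, IsZero a b c y → p₃ y → y ≤ μ₂ a b)
    (u₂ : ∀ y, IsZero a b c y → p₂ y → μ₂ a b ≤ y ∧ y ≤ μ₁ a b)
    (u₁ : ∀ y, IsZero a b c y → p₁ y → μ₁ a b ≤ y) :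
    ThreeRoots a b c S₃ S₂ S₁ {x | p₃ x} {x | p₂ x} {x | p₁ x} := by
  obtain ⟨i1, i2, i3, i4⟩ := h.interlace
  have hb := h.le_sq_div_three
  refine ⟨x₃, x₂, x₁, h.le₃₂, h.le₂₁, h.roots, s.1, s.2.1, s.2.2, i.1, i.2.1, i.2.2,
    fun y hy hI => ?_, fun y hy hI => ?_, fun y hy hI => ?_⟩
  · have hz := mem_roots_cubic hy
    have hu := u₃ y hz hI
    exact le_antisymm (le_of_le_μ₂ hb h.isZero₃ hz hu le_rfl)
      (le_of_le_μ₂ hb hz h.isZero₃ i1 le_rfl)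
  · have hz := mem_roots_cubic hy
    have hu := u₂ y hz hI
    exact le_antisymm (le_of_mem_Icc hb hz h.isZero₂ hu ⟨i2, i3⟩ le_rfl)
      (le_of_mem_Icc hb h.isZero₂ hz ⟨i2, i3⟩ hu le_rfl)
  · have hz := mem_roots_cubic hy
    have hu := u₁ y hz hI
    exact le_antisymm (le_of_μ₁_le hb h.isZero₁ hz i4 le_rfl)
      (le_of_μ₁_le hb hz h.isZero₁ hu le_rfl)

end Split

/-! ### Existence of roots -/

variable {a b c : ℝ}

theorem exists_isZero_mem_Icc {l r : ℝ} (hlr : l ≤ r) (hl : l ^ 3 + a * l ^ 2 + b * l + c ≤ 0)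
    (hr : 0 ≤ r ^ 3 + a * r ^ 2 + b * r + c) : ∃ x ∈ Icc l r, IsZero a b c x :=
  intermediate_value_Icc hlr (f := fun x => x ^ 3 + a * x ^ 2 + b * x + c)
    (by fun_prop) ⟨hl, hr⟩

theorem exists_isZero (a b c : ℝ) : ∃ x, IsZero a b c x := by
  have ha := neg_abs_le a
  have ha' := le_abs_self a
  have hb := neg_abs_le b
  have hb' := le_abs_self b
  have hc := neg_abs_le c
  have hc' := le_abs_self c
  have := abs_nonneg a
  have := abs_nonneg b
  have := abs_nonneg c
  -- R³ = R · R² exceeds |a|R² + |b|R + |c|, so the cubic changes sign between −R and R.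
  set R := 1 + |a| + |b| + |c| with hR
  have h1 : 1 ≤ R := by linarith
  have h2 : R ≤ R ^ 2 := by nlinarith
  have h3 : R ^ 3 = R ^ 2 + |a| * R ^ 2 + |b| * R ^ 2 + |c| * R ^ 2 := by
    calc R ^ 3 = R * R ^ 2 := by ring
      _ = _ := by rw [hR]; ring
  have a1 : |a * R ^ 2| = |a| * R ^ 2 := by rw [abs_mul, abs_of_nonneg (sq_nonneg R)]
  have b1 : |b * R| ≤ |b| * R ^ 2 := by
    rw [abs_mul, abs_of_nonneg (by linarith : 0 ≤ R)]; gcongr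
  have c1 : |c| ≤ |c| * R ^ 2 := le_mul_of_one_le_right (abs_nonneg c) (by linarith)
  have a2 := abs_le.1 a1.le
  have b2 := abs_le.1 b1
  have c2 := abs_le.1 c1
  obtain ⟨x, -, hx⟩ := exists_isZero_mem_Icc (a := a) (b := b) (c := c) (l := -R) (r := R)
    (by linarith) (by linarith [sq_nonneg R, a2.1, a2.2, b2.1, b2.2, c2.1, c2.2])
    (by linarith [sq_nonneg R, a2.1, a2.2, b2.1, b2.2, c2.1, c2.2])
  exact ⟨x, hx⟩

/-- At −a/3 − 2u and −a/3 + u the cubic equals c − c₁ ≤ 0, at −a/3 − u and −a/3 + 2u it equals c −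
c₂ ≥ 0. The intermediate value theorem gives the outer roots, Vieta the middle one, and these bounds
already force the ordering. -/
theorem exists_split (hb : b ≤ a ^ 2 / 3) (h₁ : c ≤ c₁ a b) (h₂ : c₂ a b ≤ c) :
    ∃ x₃ x₂ x₁, Split a b c x₃ x₂ x₁ := by
  have hs := sq_halfGap hb
  have h0 := halfGap_nonneg a b
  rw [c₁_eq hb] at h₁
  rw [c₂_eq hb] at h₂
  set u := halfGap a b
  have hbu : b = a ^ 2 / 3 - 3 * u ^ 2 := by linarith
  unfold c₀ at h₁ h₂
  clear_value u
  subst hbu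
  obtain ⟨x₃, ⟨l3, r3⟩, z3⟩ := exists_isZero_mem_Icc (a := a) (b := a ^ 2 / 3 - 3 * u ^ 2)
    (c := c) (l := -a / 3 - 2 * u) (r := -a / 3 - u) (by linarith) (by linarith) (by linarith)
  obtain ⟨x₁, ⟨l1, r1⟩, z1⟩ := exists_isZero_mem_Icc (a := a) (b := a ^ 2 / 3 - 3 * u ^ 2)
    (c := c) (l := -a / 3 + u) (r := -a / 3 + 2 * u) (by linarith) (by linarith) (by linarith)
  unfold IsZero at z3 z1
  refine ⟨x₃, -a - x₁ - x₃, x₁, ?_⟩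
  suffices h : a ^ 2 / 3 - 3 * u ^ 2 =
      x₁ * (-a - x₁ - x₃) + x₁ * x₃ + (-a - x₁ - x₃) * x₃ from
    ⟨by linarith, by linarith, by ring, h, by linear_combination z3 - x₃ * h⟩
  -- For u = 0 both intervals collapse to −a/3. Otherwise x₃ < x₁, and subtracting the two equations
  -- leaves a factor x₁ − x₃ to cancel.
  rcases h0.eq_or_lt with h0 | h0
  · rw [← h0] at l1 r1 l3 r3 ⊢
    have : x₁ = -a / 3 := by linarith
    have : x₃ = -a / 3 := by linarith
    subst x₁ x₃
    ring
  · apply mul_left_cancel₀ (sub_ne_zero.2 (by linarith : x₁ ≠ x₃) )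
    linear_combination z1 - z3

/-! ### Cubics with one real root -/

/-- The real `x` is the only real root, counted with multiplicity. -/
structure Single (a b c x : ℝ) : Prop where
  isZero : IsZero a b c x
  cofactor_pos : ∀ e, 0 < e ^ 2 + (a + x) * e + (b + a * x + x ^ 2)

/-- The hypothesis says that the discriminant is negative, stated without square roots so that it
also covers b > a²/3. -/
theorem exists_single (h : 4 * ((a ^ 2 - 3 * b) / 9) ^ 3 < (c - c₀ a b) ^ 2) :
    ∃ x, Single a b c x := by
  obtain ⟨x, hx⟩ := exists_isZero a b c
  refine ⟨x, hx, fun e => ?_⟩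
  unfold IsZero at hx
  unfold c₀ at h
  obtain ⟨y, rfl⟩ : ∃ y, x = -a / 3 + y := ⟨x + a / 3, by ring⟩
  obtain ⟨U, rfl⟩ : ∃ U, b = a ^ 2 / 3 - 3 * U := ⟨(a ^ 2 / 3 - b) / 3, by ring⟩
  have hk : c - (-(2 / 27) * a ^ 3 + 1 / 3 * a * (a ^ 2 / 3 - 3 * U)) = -(y * (y ^ 2 - 3 * U)) := by
    linear_combination hx
  rw [hk] at h
  -- y²(y² − 3U)² − 4U³ = (y² − 4U)(y² − U)².
  have hU : 4 * U < y ^ 2 := by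
    by_contra! hy
    nlinarith [mul_nonneg (sub_nonneg.2 hy) (sq_nonneg (U - y ^ 2))]
  -- The quadratic cofactor has discriminant 3(4U − y²) < 0; complete the square.
  nlinarith [sq_nonneg (e + (a + (-a / 3 + y)) / 2)]

theorem exists_single_of_c₁_lt (hb : b ≤ a ^ 2 / 3) (h : c₁ a b < c) : ∃ x, Single a b c x := by
  apply exists_single
  have h0 := halfGap_nonneg a b
  rw [c₁_eq hb] at h
  rw [show (a ^ 2 - 3 * b) / 9 = halfGap a b ^ 2 by rw [sq_halfGap hb]; ring]
  have := pow_nonneg h0 3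
  nlinarith

theorem exists_single_of_lt_c₂ (hb : b ≤ a ^ 2 / 3) (h : c < c₂ a b) : ∃ x, Single a b c x := by
  apply exists_single
  have h0 := halfGap_nonneg a b
  rw [c₂_eq hb] at h
  rw [show (a ^ 2 - 3 * b) / 9 = halfGap a b ^ 2 by rw [sq_halfGap hb]; ring]
  have := pow_nonneg h0 3
  nlinarith

theorem exists_single_of_lt (hb : a ^ 2 / 3 < b) : ∃ x, Single a b c x := by
  apply exists_single
  have : 0 < ((3 * b - a ^ 2) / 9) ^ 3 := pow_pos (by linarith) 3
  nlinarith [sq_nonneg (c - c₀ a b)]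

namespace Single

variable {c' x e : ℝ}

theorem factor (h : Single a b c x) (e : ℝ) : e ^ 3 + a * e ^ 2 + b * e + c =
    (e - x) * (e ^ 2 + (a + x) * e + (b + a * x + x ^ 2)) := by
  have := h.isZero
  unfold IsZero at this
  linear_combination this

theorem roots (h : Single a b c x) : (cubic a b c).roots = {x} := by
  have hc : c = -(x * (b + a * x + x ^ 2)) := by
    have := h.isZero
    unfold IsZero at this
    linear_combination this
  have hf : cubic a b c =
      (X - C x) * (X ^ 2 + C (a + x) * X + C (b + a * x + x ^ 2)) := by
    unfold cubic
    rw [hc]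
    simp
    ring
  have h0 : cubic a b c ≠ 0 := by
    intro h0
    have := congrArg (fun p => p.coeff 3) h0
    simp [cubic] at this
  rw [hf] at h0 ⊢
  rw [roots_mul h0, roots_X_sub_C, add_eq_left, Multiset.eq_zero_iff_forall_notMem]
  intro y hy
  have := (mem_roots'.1 hy).2
  simp [IsRoot] at this
  linarith [h.cofactor_pos y]

theorem lt_of_neg (h : Single a b c x) (he : e ^ 3 + a * e ^ 2 + b * e + c < 0) : e < x := by
  rw [h.factor] at he
  have := h.cofactor_pos e
  by_contra! hx
  nlinarith [mul_nonneg (sub_nonneg.2 hx) this.le]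

theorem lt_of_pos (h : Single a b c x) (he : 0 < e ^ 3 + a * e ^ 2 + b * e + c) : x < e := by
  rw [h.factor] at he
  have := h.cofactor_pos e
  by_contra! hx
  nlinarith [mul_nonneg (sub_nonneg.2 hx) this.le]

/-- The value at a zero belonging to the free term c' is c − c'. Comparing free terms thus compares
the root with a landmark. -/
theorem gt (h : Single a b c x) (he : IsZero a b c' e) (hc : c < c') : e < x :=
  h.lt_of_neg (by unfold IsZero at he; linarith)

theorem lt (h : Single a b c x) (he : IsZero a b c' e) (hc : c' < c) : x < e :=
  h.lt_of_pos (by unfold IsZero at he; linarith)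

theorem eq (h : Single a b c x) (he : IsZero a b c e) : e = x := by
  have hf := h.factor e
  rw [he] at hf
  exact sub_eq_zero.1 ((mul_eq_zero.1 hf.symm).resolve_right (h.cofactor_pos e).ne')

theorem ge (h : Single a b c x) (he : IsZero a b c' e) (hc : c ≤ c') : e ≤ x := by
  rcases hc.lt_or_eq with hc | rfl
  · exact (h.gt he hc).le
  · exact (h.eq he).le

theorem le (h : Single a b c x) (he : IsZero a b c' e) (hc : c' ≤ c) : x ≤ e := by
  rcases hc.lt_or_eq with hc | rfl
  · exact (h.lt he hc).le
  · exact (h.eq he).ge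

theorem oneRoot {S : Set ℝ} {p : ℝ → Prop} (h : Single a b c x) (s : x ∈ S) (i : p x) :
    OneRoot a b c S {x | p x} := ⟨x, h.roots, s, i⟩

end Single

/-! ### Comparison of a root with `-c / b` -/

section
variable {x : ℝ}

theorem IsZero.ne_zero (h : IsZero a b c x) (hc : c ≠ 0) : x ≠ 0 := by
  rintro rfl
  simp [IsZero] at h
  exact hc h

/-- At a root bx + c = −x²(x + a), so the side of −a on which x lies decides its comparison with
−c/b, in a direction set by the sign of b. In the strict variants c ≠ 0 ensures x ≠ 0. -/
theorem IsZero.neg_div_le_of_pos (h : IsZero a b c x) (hb : 0 < b) (hx : x ≤ -a) :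
    -c / b ≤ x := by
  unfold IsZero at h
  rw [div_le_iff₀ hb]
  nlinarith [mul_nonneg (sq_nonneg x) (show 0 ≤ -a - x by linarith)]

theorem IsZero.le_neg_div_of_pos (h : IsZero a b c x) (hb : 0 < b) (hx : -a ≤ x) :
    x ≤ -c / b := by
  unfold IsZero at h
  rw [le_div_iff₀ hb]
  nlinarith [mul_nonneg (sq_nonneg x) (show 0 ≤ x + a by linarith)]

theorem IsZero.neg_div_lt_of_pos (h : IsZero a b c x) (hb : 0 < b) (hc : c ≠ 0) (hx : x < -a) :
    -c / b < x := by
  have := h.ne_zero hc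
  unfold IsZero at h
  rw [div_lt_iff₀ hb]
  nlinarith [mul_pos (pow_pos (abs_pos.2 this) 2) (show 0 < -a - x by linarith), sq_abs x]

theorem IsZero.lt_neg_div_of_pos (h : IsZero a b c x) (hb : 0 < b) (hc : c ≠ 0) (hx : -a < x) :
    x < -c / b := by
  have := h.ne_zero hc
  unfold IsZero at h
  rw [lt_div_iff₀ hb]
  nlinarith [mul_pos (pow_pos (abs_pos.2 this) 2) (show 0 < x + a by linarith), sq_abs x]

theorem IsZero.le_neg_div_of_neg (h : IsZero a b c x) (hb : b < 0) (hx : x ≤ -a) :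
    x ≤ -c / b := by
  unfold IsZero at h
  rw [le_div_iff_of_neg hb]
  nlinarith [mul_nonneg (sq_nonneg x) (show 0 ≤ -a - x by linarith)]

theorem IsZero.neg_div_le_of_neg (h : IsZero a b c x) (hb : b < 0) (hx : -a ≤ x) :
    -c / b ≤ x := by
  unfold IsZero at h
  rw [div_le_iff_of_neg hb]
  nlinarith [mul_nonneg (sq_nonneg x) (show 0 ≤ x + a by linarith)]

theorem IsZero.neg_div_lt_of_neg (h : IsZero a b c x) (hb : b < 0) (hc : c ≠ 0) (hx : -a < x) :
    -c / b < x := by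
  have := h.ne_zero hc
  unfold IsZero at h
  rw [div_lt_iff_of_neg hb]
  nlinarith [mul_pos (pow_pos (abs_pos.2 this) 2) (show 0 < x + a by linarith), sq_abs x]

end

/-! ### Explicit splittings -/

/-- For this free term the cubic is odd about −a/3, namely (x + a/3)((x + a/3)² − (a²/3 − b)). -/
theorem split_c₀ (hb : b ≤ a ^ 2 / 3) : Split a b (c₀ a b) (ρ₂ a b) (ρ₀ a) (ρ₁ a b) := by
  have hs := Real.sq_sqrt (sub_nonneg.2 hb)
  have h0 := Real.sqrt_nonneg (a ^ 2 / 3 - b)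
  unfold c₀ ρ₂ ρ₀ ρ₁
  set t := √(a ^ 2 / 3 - b)
  refine ⟨by linarith, by linarith, by ring, ?_, ?_⟩
  · linear_combination hs
  · linear_combination (a / 3) * hs

theorem split_c₁ (hb : b ≤ a ^ 2 / 3) : Split a b (c₁ a b) (ξ₁ a b) (μ₁ a b) (μ₁ a b) := by
  have hs := sq_halfGap hb
  have h0 := halfGap_nonneg a b
  rw [c₁_eq hb, ξ₁_eq, μ₁_eq, c₀]
  refine ⟨by linarith, by linarith, by ring, ?_, ?_⟩
  · linear_combination 3 * hs
  · linear_combination a * hs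

theorem split_c₂ (hb : b ≤ a ^ 2 / 3) : Split a b (c₂ a b) (μ₂ a b) (μ₂ a b) (ξ₂ a b) := by
  have hs := sq_halfGap hb
  have h0 := halfGap_nonneg a b
  rw [c₂_eq hb, ξ₂_eq, μ₂_eq, c₀]
  refine ⟨by linarith, by linarith, by ring, ?_, ?_⟩
  · linear_combination 3 * hs
  · linear_combination a * hs

theorem lam_vieta (hb : b ≤ a ^ 2 / 4) : lam₂ a b ≤ lam₁ a b ∧ lam₁ a b + lam₂ a b = -a ∧
    lam₁ a b * lam₂ a b = b := by
  have hs := Real.sq_sqrt (sub_nonneg.2 hb)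
  have h0 := Real.sqrt_nonneg (a ^ 2 / 4 - b)
  unfold lam₁ lam₂
  set t := √(a ^ 2 / 4 - b)
  refine ⟨by linarith, by ring, ?_⟩
  linear_combination -hs

/-- The cubic is x(x² + ax + b). The sum −a and product b of the quadratic's roots decide where 0
falls among them, which is why three versions occur. -/
theorem split_zero_of_nonpos (hb : b ≤ 0) : Split a b 0 (lam₂ a b) 0 (lam₁ a b) := by
  obtain ⟨h1, h2, h3⟩ := lam_vieta (a := a) (b := b) (by nlinarith)
  exact ⟨by by_contra! h; nlinarith, by by_contra! h; nlinarith, by linarith, by linarith, by ring⟩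

theorem split_zero_of_neg_of_nonneg (ha : a < 0) (hb : 0 ≤ b) (hb' : b ≤ a ^ 2 / 4) :
    Split a b 0 0 (lam₂ a b) (lam₁ a b) := by
  obtain ⟨h1, h2, h3⟩ := lam_vieta hb'
  exact ⟨by by_contra! h; nlinarith, h1, by linarith, by linarith, by ring⟩

theorem split_zero_of_pos_of_nonneg (ha : 0 < a) (hb : 0 ≤ b) (hb' : b ≤ a ^ 2 / 4) :
    Split a b 0 (lam₂ a b) (lam₁ a b) 0 := by
  obtain ⟨h1, h2, h3⟩ := lam_vieta hb'
  exact ⟨h1, by by_contra! h; nlinarith, by linarith, by linarith, by ring⟩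

/-- The cubic is (x + a)(x² + b). The order of −a and √(−b) is left open, and only the sum and
product of their minimum and maximum are needed. -/
theorem split_mul_of_nonpos (ha : a ≤ 0) (hb : b ≤ 0) :
    Split a b (a * b) (-√(-b)) (min (-a) √(-b)) (max (-a) √(-b)) := by
  have hs := Real.sq_sqrt (neg_nonneg.2 hb)
  have h0 := Real.sqrt_nonneg (-b)
  set s := √(-b)
  refine ⟨le_min (by linarith) (by linarith), min_le_max, ?_, ?_, ?_⟩
  · linarith [min_add_max (-a) s]
  · linear_combination s * min_add_max (-a) s - min_mul_max (-a) s + hs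
  · linear_combination a * hs - s * min_mul_max (-a) s

theorem split_mul_of_nonneg (ha : 0 ≤ a) (hb : b ≤ 0) :
    Split a b (a * b) (min (-a) (-√(-b))) (max (-a) (-√(-b))) √(-b) := by
  have hs := Real.sq_sqrt (neg_nonneg.2 hb)
  have h0 := Real.sqrt_nonneg (-b)
  set s := √(-b)
  refine ⟨min_le_max, max_le (by linarith) (by linarith), ?_, ?_, ?_⟩
  · linarith [min_add_max (-a) (-s)]
  · linear_combination -s * min_add_max (-a) (-s) - min_mul_max (-a) (-s) + hs
  · linear_combination a * hs + s * min_mul_max (-a) (-s)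

/-- Both neighbours lie in [c₂, c₁], so c does too and the three roots exist; monotonicity in the
free term encloses each of them. -/
theorem Split.of_between {c' c'' y₃ y₂ y₁ z₃ z₂ z₁ : ℝ} (h' : Split a b c' y₃ y₂ y₁)
    (h'' : Split a b c'' z₃ z₂ z₁) (hc' : c ≤ c') (hc'' : c'' < c) :
    ∃ x₃ x₂ x₁, Split a b c x₃ x₂ x₁ ∧ (y₃ ≤ x₃ ∧ x₃ < z₃) ∧ (z₂ < x₂ ∧ x₂ ≤ y₂) ∧
      y₁ ≤ x₁ ∧ x₁ < z₁ := by
  obtain ⟨x₃, x₂, x₁, h⟩ := exists_split h'.le_sq_div_three (hc'.trans h'.le_c₁)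
    (h''.c₂_le.trans hc''.le)
  obtain ⟨l3, l2, l1⟩ := h.le h' hc'
  obtain ⟨k3, k2, k1⟩ := h''.lt h hc''
  exact ⟨x₃, x₂, x₁, h, ⟨l3, k3⟩, ⟨k2, l2⟩, l1, k1⟩

theorem Split.of_between_le {c' c'' y₃ y₂ y₁ z₃ z₂ z₁ : ℝ} (h' : Split a b c' y₃ y₂ y₁)
    (h'' : Split a b c'' z₃ z₂ z₁) (hc' : c ≤ c') (hc'' : c'' ≤ c) :
    ∃ x₃ x₂ x₁, Split a b c x₃ x₂ x₁ ∧ (y₃ ≤ x₃ ∧ x₃ ≤ z₃) ∧ (z₂ ≤ x₂ ∧ x₂ ≤ y₂) ∧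
      y₁ ≤ x₁ ∧ x₁ ≤ z₁ := by
  obtain ⟨x₃, x₂, x₁, h⟩ := exists_split h'.le_sq_div_three (hc'.trans h'.le_c₁)
    (h''.c₂_le.trans hc'')
  obtain ⟨l3, l2, l1⟩ := h.le h' hc'
  obtain ⟨k3, k2, k1⟩ := h''.le h hc''
  exact ⟨x₃, x₂, x₁, h, ⟨l3, k3⟩, ⟨k2, l2⟩, l1, k1⟩

/-! ### Signs -/

theorem μ_vieta (hb : b ≤ a ^ 2 / 3) : μ₂ a b ≤ μ₁ a b ∧ μ₁ a b + μ₂ a b = -(2 / 3) * a ∧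
    μ₁ a b * μ₂ a b = b / 3 := by
  have hs := sq_halfGap hb
  have h0 := halfGap_nonneg a b
  rw [μ₁_eq, μ₂_eq]
  exact ⟨by linarith, by ring, by linear_combination -hs⟩

theorem μ_sign_of_neg (hb : b < 0) : μ₂ a b < 0 ∧ 0 < μ₁ a b := by
  obtain ⟨h1, h2, h3⟩ := μ_vieta (a := a) (b := b) (by nlinarith)
  constructor <;> by_contra! h <;> nlinarith

theorem μ₂_pos (ha : a < 0) (hb : 0 < b) (hb' : b ≤ a ^ 2 / 3) : 0 < μ₂ a b := by
  obtain ⟨h1, h2, h3⟩ := μ_vieta hb'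
  by_contra! h
  nlinarith

theorem μ₁_neg (ha : 0 < a) (hb : 0 < b) (hb' : b ≤ a ^ 2 / 3) : μ₁ a b < 0 := by
  obtain ⟨h1, h2, h3⟩ := μ_vieta hb'
  by_contra! h
  nlinarith

theorem lam_sign_of_neg (hb : b < 0) : lam₂ a b < 0 ∧ 0 < lam₁ a b := by
  obtain ⟨h1, h2, h3⟩ := lam_vieta (a := a) (b := b) (by nlinarith)
  constructor <;> by_contra! h <;> nlinarith

theorem lam₂_pos (ha : a < 0) (hb : 0 < b) (hb' : b ≤ a ^ 2 / 4) : 0 < lam₂ a b := by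
  obtain ⟨h1, h2, h3⟩ := lam_vieta hb'
  by_contra! h
  nlinarith

theorem lam₁_neg (ha : 0 < a) (hb : 0 < b) (hb' : b ≤ a ^ 2 / 4) : lam₁ a b < 0 := by
  obtain ⟨h1, h2, h3⟩ := lam_vieta hb'
  by_contra! h
  nlinarith

section
variable {x : ℝ}

/-- At a root (x + a)(x² + b) = ab − c, and x² + b > 0. Applied to double roots, this shows that ab
lies outside [c₂, c₁] in the ranges with b > 0. -/
theorem IsZero.lt_mul (h : IsZero a b c x) (hb : 0 < b) (hx : -a < x) : c < a * b := by
  unfold IsZero at h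
  nlinarith [mul_pos (show 0 < x + a by linarith) (show 0 < x ^ 2 + b by positivity)]

theorem IsZero.mul_lt (h : IsZero a b c x) (hb : 0 < b) (hx : x < -a) : a * b < c := by
  unfold IsZero at h
  nlinarith [mul_pos (show 0 < -a - x by linarith) (show 0 < x ^ 2 + b by positivity)]

/-- For b > a²/4 the factor x² + ax + b is positive, so x(x² + ax + b) = −c makes x and −c agree in
sign; the next three lemmas are variants. -/
theorem IsZero.pos_of_neg (h : IsZero a b c x) (hb : a ^ 2 / 4 < b) (hc : c < 0) : 0 < x := by
  unfold IsZero at h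
  have : 0 < x ^ 2 + a * x + b := by nlinarith [sq_nonneg (x + a / 2)]
  by_contra! hx
  nlinarith [mul_nonneg (neg_nonneg.2 hx) this.le]

theorem IsZero.neg_of_pos (h : IsZero a b c x) (hb : a ^ 2 / 4 < b) (hc : 0 < c) : x < 0 := by
  unfold IsZero at h
  have : 0 < x ^ 2 + a * x + b := by nlinarith [sq_nonneg (x + a / 2)]
  by_contra! hx
  nlinarith [mul_nonneg hx this.le]

theorem IsZero.neg_of_neg (h : IsZero a b c x) (hb : a ^ 2 / 4 < b) (hx : 0 < x) : c < 0 := by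
  unfold IsZero at h
  have : 0 < x ^ 2 + a * x + b := by nlinarith [sq_nonneg (x + a / 2)]
  nlinarith [mul_pos hx this]

theorem IsZero.pos_of_pos (h : IsZero a b c x) (hb : a ^ 2 / 4 < b) (hx : x < 0) : 0 < c := by
  unfold IsZero at h
  have : 0 < x ^ 2 + a * x + b := by nlinarith [sq_nonneg (x + a / 2)]
  nlinarith [mul_pos (neg_pos.2 hx) this]

end

/-! ### Bounds for the roots -/

namespace Single

variable {x M : ℝ}

/-- With R = 1 + M one has R³ = MR² + MR + M + 1, so the value at −R is at most −1. For this end,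
one-sided bounds on a and c suffice. -/
theorem neg_one_add_lt (h : Single a b c x) (ha : a ≤ M) (hb : |b| ≤ M) (hc : c ≤ M) :
    -(1 + M) < x := by
  apply h.lt_of_neg
  have h0 : 0 ≤ M := (abs_nonneg b).trans hb
  have hb' := (abs_le.1 hb).1
  nlinarith [mul_le_mul_of_nonneg_right ha (sq_nonneg (1 + M)),
    mul_le_mul_of_nonneg_right hb' (by linarith : 0 ≤ 1 + M)]

theorem lt_one_add (h : Single a b c x) (ha : -a ≤ M) (hb : |b| ≤ M) (hc : -c ≤ M) :
    x < 1 + M := by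
  apply h.lt_of_pos
  have h0 : 0 ≤ M := (abs_nonneg b).trans hb
  have hb' := (abs_le.1 hb).1
  nlinarith [mul_le_mul_of_nonneg_right ha (sq_nonneg (1 + M)),
    mul_le_mul_of_nonneg_right hb' (by linarith : 0 ≤ 1 + M)]

/-- For a ≤ 0 the quadratic term helps at −R. With M = s² and R = 1 + s, M(R + 1) = R³ − R² − R + 1
< R³. -/
theorem neg_one_add_sqrt_lt (h : Single a b c x) (ha : a ≤ 0) (hb : |b| ≤ M) (hc : c ≤ M) :
    -(1 + √M) < x := by
  apply h.lt_of_neg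
  have h0 : 0 ≤ M := (abs_nonneg b).trans hb
  have hb' := (abs_le.1 hb).1
  have hs := Real.sq_sqrt h0
  have hs0 := Real.sqrt_nonneg M
  generalize √M = s at *
  subst hs
  nlinarith [mul_le_mul_of_nonneg_right ha (sq_nonneg (1 + s)),
    mul_le_mul_of_nonneg_right hb' (by linarith : 0 ≤ 1 + s)]

theorem lt_one_add_sqrt (h : Single a b c x) (ha : 0 ≤ a) (hb : |b| ≤ M) (hc : -c ≤ M) :
    x < 1 + √M := by
  apply h.lt_of_pos
  have h0 : 0 ≤ M := (abs_nonneg b).trans hb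
  have hb' := (abs_le.1 hb).1
  have hs := Real.sq_sqrt h0
  have hs0 := Real.sqrt_nonneg M
  generalize √M = s at *
  subst hs
  nlinarith [mul_le_mul_of_nonneg_right ha (sq_nonneg (1 + s)),
    mul_le_mul_of_nonneg_right hb' (by linarith : 0 ≤ 1 + s)]

end Single

/-! ### Location of a single root -/

theorem exists_single_lt_ξ₁ (hb : b ≤ a ^ 2 / 3) (h : c₁ a b < c) :
    ∃ x, Single a b c x ∧ x < ξ₁ a b := by
  obtain ⟨x, hx⟩ := exists_single_of_c₁_lt hb h
  exact ⟨x, hx, hx.lt (split_c₁ hb).isZero₃ h⟩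

theorem exists_single_ξ₂_lt (hb : b ≤ a ^ 2 / 3) (h : c < c₂ a b) :
    ∃ x, Single a b c x ∧ ξ₂ a b < x := by
  obtain ⟨x, hx⟩ := exists_single_of_lt_c₂ hb h
  exact ⟨x, hx, hx.gt (split_c₂ hb).isZero₁ h⟩

namespace Single

variable {x : ℝ}

theorem neg_div_lt (h : Single a b c x) (hb : 0 < b) (h0 : c ≠ 0) (hc : a * b < c) :
    -c / b < x ∧ x < -a :=
  have hx := h.lt (isZero_neg a b) hc
  ⟨h.isZero.neg_div_lt_of_pos hb h0 hx, hx⟩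

theorem lt_neg_div (h : Single a b c x) (hb : 0 < b) (h0 : c ≠ 0) (hc : c < a * b) :
    -a < x ∧ x < -c / b :=
  have hx := h.gt (isZero_neg a b) hc
  ⟨hx, h.isZero.lt_neg_div_of_pos hb h0 hx⟩

theorem neg_div_ltUnless (h : Single a b c x) (hb : 0 < b) (h0 : c ≠ 0) (hc : a * b ≤ c) :
    LtUnless (c = a * b) (-c / b) x ∧ x ≤ -a :=
  have hx := h.le (isZero_neg a b) hc
  ⟨⟨h.isZero.neg_div_le_of_pos hb hx, fun hne => (h.neg_div_lt hb h0 (hc.lt_of_ne' hne)).1⟩, hx⟩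

theorem ltUnless_neg_div (h : Single a b c x) (hb : 0 < b) (h0 : c ≠ 0) (hc : c ≤ a * b) :
    -a ≤ x ∧ LtUnless (c = a * b) x (-c / b) :=
  have hx := h.ge (isZero_neg a b) hc
  ⟨hx, h.isZero.le_neg_div_of_pos hb hx, fun hne => (h.lt_neg_div hb h0 (hc.lt_of_ne hne)).2⟩

end Single

/-- The splittings for the free terms `c₀`, `c₁` and `c₂`, and the order of their roots. -/
theorem landmarks (hb : b ≤ a ^ 2 / 3) :
    Split a b (c₀ a b) (ρ₂ a b) (ρ₀ a) (ρ₁ a b) ∧ Split a b (c₁ a b) (ξ₁ a b) (μ₁ a b) (μ₁ a b) ∧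
      Split a b (c₂ a b) (μ₂ a b) (μ₂ a b) (ξ₂ a b) ∧ c₂ a b ≤ c₀ a b ∧ c₀ a b ≤ c₁ a b ∧
      (ξ₁ a b ≤ μ₂ a b ∧ μ₁ a b ≤ ξ₂ a b) ∧
      (ρ₂ a b ≤ μ₂ a b ∧ μ₂ a b ≤ ρ₀ a ∧ ρ₀ a ≤ μ₁ a b ∧ μ₁ a b ≤ ρ₁ a b) ∧ ρ₀ a = -a / 3 :=
  have s0 := split_c₀ hb
  have s1 := split_c₁ hb
  have s2 := split_c₂ hb
  ⟨s0, s1, s2, s0.c₂_le, s0.le_c₁, ⟨s1.interlace.1, s2.interlace.2.2.2⟩, s0.interlace, rfl⟩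

/-- Used with the splittings for 0 and ab, it orders these values against c₁ and c₂. -/
theorem Split.mem_Icc {x₃ x₂ x₁ : ℝ} (h : Split a b c x₃ x₂ x₁) : c ∈ Icc (c₂ a b) (c₁ a b) :=
  ⟨h.c₂_le, h.le_c₁⟩

/-! ### Lists of cases -/

section
variable {p₁ p₂ p₃ p₄ p₅ p₆ q₁ q₂ q₃ q₄ q₅ q₆ : Prop}

theorem valid_four (h : (p₁ ∨ p₂ ∨ p₃ ∨ p₄) ∧
      (¬(p₁ ∧ p₂) ∧ ¬(p₁ ∧ p₃) ∧ ¬(p₁ ∧ p₄)) ∧ (¬(p₂ ∧ p₃) ∧ ¬(p₂ ∧ p₄)) ∧ ¬(p₃ ∧ p₄))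
    (h₁ : p₁ → q₁) (h₂ : p₂ → q₂) (h₃ : p₃ → q₃) (h₄ : p₄ → q₄) :
    Valid [(p₁, q₁), (p₂, q₂), (p₃, q₃), (p₄, q₄)] := by
  refine ⟨?_, ?_, ?_⟩
  · simpa using h.1
  · simpa using h.2
  · simpa using ⟨h₁, h₂, h₃, h₄⟩

theorem valid_six (h : (p₁ ∨ p₂ ∨ p₃ ∨ p₄ ∨ p₅ ∨ p₆) ∧
      (¬(p₁ ∧ p₂) ∧ ¬(p₁ ∧ p₃) ∧ ¬(p₁ ∧ p₄) ∧ ¬(p₁ ∧ p₅) ∧ ¬(p₁ ∧ p₆)) ∧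
      (¬(p₂ ∧ p₃) ∧ ¬(p₂ ∧ p₄) ∧ ¬(p₂ ∧ p₅) ∧ ¬(p₂ ∧ p₆)) ∧
      (¬(p₃ ∧ p₄) ∧ ¬(p₃ ∧ p₅) ∧ ¬(p₃ ∧ p₆)) ∧ (¬(p₄ ∧ p₅) ∧ ¬(p₄ ∧ p₆)) ∧ ¬(p₅ ∧ p₆))
    (h₁ : p₁ → q₁) (h₂ : p₂ → q₂) (h₃ : p₃ → q₃) (h₄ : p₄ → q₄) (h₅ : p₅ → q₅) (h₆ : p₆ → q₆) :
    Valid [(p₁, q₁), (p₂, q₂), (p₃, q₃), (p₄, q₄), (p₅, q₅), (p₆, q₆)] := by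
  refine ⟨?_, ?_, ?_⟩
  · simpa using h.1
  · simpa only [List.pairwise_cons, List.forall_mem_cons, List.not_mem_nil, false_imp_iff,
      implies_true, and_true, List.Pairwise.nil] using h.2
  · simpa using ⟨h₁, h₂, h₃, h₄, h₅, h₆⟩

end

/-! ### The depressed cubic -/

theorem valid_depressedNeg (ha : a = 0) (hb : b < 0) : Valid (depressedNeg a b c) := by
  have hb3 : b ≤ a ^ 2 / 3 := by subst ha; linarith
  have hs := Real.sqrt_pos.2 (neg_pos.2 hb)
  have s1 := split_c₁ hb3
  have s2 := split_c₂ hb3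
  -- For a = 0 the special values 0, ab and c₀ coincide, so one splitting replaces three.
  have s0 : Split a b 0 (-√(-b)) 0 √(-b) := by
    have := Real.sq_sqrt (neg_pos.2 hb).le
    exact ⟨by linarith, by linarith, by rw [ha]; ring, by linear_combination this, by ring⟩
  have := s0.le_c₁
  have := s0.c₂_le
  have i0 := s0.interlace
  have i1 := s1.interlace
  have i2 := s2.interlace
  have hμ := μ_sign_of_neg (a := a) hb
  refine valid_four (by grind -mbtc) (fun h => ?_) (fun ⟨h1, h2⟩ => ?_) (fun ⟨h1, h2⟩ => ?_)
    (fun h => ?_)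
  · obtain ⟨x, hx⟩ := exists_single_of_c₁_lt hb3 (neg_lt_neg_iff.1 h)
    have := hx.lt s1.isZero₃ (neg_lt_neg_iff.1 h)
    have := hx.neg_one_add_lt (M := max |b| c) (by simp [ha]) (by simp) (by simp)
    refine hx.oneRoot ?_ ?_ <;> grind -mbtc
  · obtain ⟨x₃, x₂, x₁, h, l, r⟩ :=
      s1.of_between s0 (neg_le_neg_iff.1 h1) (neg_lt_zero.1 h2)
    have := h.isZero₂.neg_div_lt_of_neg hb (by linarith) (by linarith)
    -- Since μ₂ < 0, this keeps the second interval on the middle branch.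
    have : 0 < -c / b := div_pos_of_neg_of_neg h2 hb
    refine h.threeRoots ?_ ?_ ?_ ?_ ?_ <;> grind -mbtc
  · obtain ⟨x₃, x₂, x₁, h, l, r⟩ :=
      s0.of_between_le s2 (by linarith) (neg_le_neg_iff.1 h2)
    have := h.isZero₂.le_neg_div_of_neg hb (by linarith)
    have : -c / b ≤ 0 := div_nonpos_of_nonneg_of_nonpos h1 hb.le
    refine h.threeRoots ?_ ?_ ?_ ?_ ?_ <;> grind -mbtc
  · obtain ⟨x, hx⟩ := exists_single_of_lt_c₂ hb3 (neg_lt_neg_iff.1 h)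
    have := hx.gt s2.isZero₁ (neg_lt_neg_iff.1 h)
    have := hx.lt_one_add (M := max |b| |c|) (by simp [ha]) (by simp) (by simp [neg_le_abs])
    refine hx.oneRoot ?_ ?_ <;> grind -mbtc

/-! ### Negative `b` -/

/-- Here 0 < c₀ < ab, because a, a² + 9b and 9b − 2a² are all negative. For a > 0 the order is
reversed. -/
theorem valid_regime1Neg (hb9 : b < -(a ^ 2 / 9)) (ha : a < 0) :
    Valid (regime1Neg a b c) := by
  have hb : b < 0 := by nlinarith
  have hb3 : b ≤ a ^ 2 / 3 := by nlinarith
  obtain ⟨s0, s1, s2, _, _, ho⟩ := landmarks hb3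
  have sz := split_zero_of_nonpos (a := a) hb.le
  have sm := split_mul_of_nonpos ha.le hb.le
  have iz := sz.interlace
  have im := sm.interlace
  have hμ := μ_sign_of_neg (a := a) hb
  have hlam := lam_sign_of_neg (a := a) hb
  have hs0 := Real.sqrt_pos.2 (neg_pos.2 hb)
  have ⟨_, _⟩ := sz.mem_Icc
  have ⟨_, _⟩ := sm.mem_Icc
  have : 0 < a * (a ^ 2 + 9 * b) := by
    nlinarith [mul_pos (neg_pos.2 ha) (show 0 < -(a ^ 2 + 9 * b) by linarith)]
  have hm0 : c₀ a b < a * b := by unfold c₀; linarith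
  have hz0 : 0 < c₀ a b := by
    unfold c₀
    nlinarith [mul_pos (neg_pos.2 ha) (neg_pos.2 hb), pow_pos (neg_pos.2 ha) 3]
  refine valid_six (by grind -mbtc (splits := 30)) (fun h => ?_) (fun ⟨h1, h2⟩ => ?_)
    (fun ⟨h1, h2⟩ => ?_) (fun ⟨h1, h2⟩ => ?_) (fun ⟨h1, h2⟩ => ?_) (fun h => ?_)
  · obtain ⟨x, hx, _⟩ := exists_single_lt_ξ₁ hb3 (by linarith)
    have := hx.neg_one_add_sqrt_lt (M := max |b| c) ha.le (by simp) (by simp)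
    refine hx.oneRoot ?_ ?_ <;> grind -mbtc [LtUnless]
  · obtain ⟨x₃, x₂, x₁, h, l, r⟩ :=
      s1.of_between sm (neg_le_neg_iff.1 h1) (neg_lt_neg_iff.1 h2)
    have : 0 < min (-a) √(-b) := lt_min (by linarith) hs0
    refine h.threeRoots ?_ ?_ ?_ ?_ ?_ <;> grind -mbtc [LtUnless]
  · obtain ⟨x₃, x₂, x₁, h, l, r⟩ :=
      sm.of_between s0 (neg_le_neg_iff.1 h1) (neg_lt_neg_iff.1 h2)
    have := h.isZero₂.le_neg_div_of_neg hb (by grind)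
    -- The bound √(−b) alone may exceed μ₁. A root below −c/b is also at most −a, and the smaller of
    -- −a and √(−b) is at most μ₁ by interlacing.
    have : ∀ y, IsZero a b c y → y ≤ -c / b → y ≤ -a := fun y hy hyc => by
      by_contra! hya
      exact (hy.neg_div_lt_of_neg hb (by linarith) hya).not_ge hyc
    refine h.threeRoots ?_ ?_ ?_ ?_ ?_ <;> grind -mbtc [LtUnless]
  · obtain ⟨x₃, x₂, x₁, h, l, r⟩ :=
      s0.of_between sz (neg_le_neg_iff.1 h1) (by linarith)
    have := h.isZero₂.le_neg_div_of_neg hb (by grind)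
    refine h.threeRoots ?_ ?_ ?_ ?_ ?_ <;> grind -mbtc [LtUnless]
  · obtain ⟨x₃, x₂, x₁, h, l, r⟩ :=
      sz.of_between_le s2 (by linarith) (neg_le_neg_iff.1 h2)
    have := h.isZero₂.le_neg_div_of_neg hb (by grind)
    have : -c / b ≤ 0 := div_nonpos_of_nonneg_of_nonpos h1 hb.le
    refine h.threeRoots ?_ ?_ ?_ ?_ ?_ <;> grind -mbtc [LtUnless]
  · obtain ⟨x, hx, _⟩ := exists_single_ξ₂_lt hb3 (by linarith)
    have := hx.lt_one_add (M := max |a| (max |b| |c|)) (by simp [neg_le_abs]) (by simp)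
      (by simp [neg_le_abs])
    refine hx.oneRoot ?_ ?_ <;> grind -mbtc [LtUnless]

set_option maxHeartbeats 800000 in
theorem valid_regime1Pos (hb9 : b < -(a ^ 2 / 9)) (ha : 0 < a) :
    Valid (regime1Pos a b c) := by
  have hb : b < 0 := by nlinarith
  have hb3 : b ≤ a ^ 2 / 3 := by nlinarith
  obtain ⟨s0, s1, s2, _, _, ho⟩ := landmarks hb3
  have sz := split_zero_of_nonpos (a := a) hb.le
  have sm := split_mul_of_nonneg ha.le hb.le
  have iz := sz.interlace
  have im := sm.interlace
  have hμ := μ_sign_of_neg (a := a) hb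
  have hlam := lam_sign_of_neg (a := a) hb
  have hs0 := Real.sqrt_pos.2 (neg_pos.2 hb)
  have ⟨_, _⟩ := sz.mem_Icc
  have ⟨_, _⟩ := sm.mem_Icc
  have : 0 < -(a * (a ^ 2 + 9 * b)) := by
    nlinarith [mul_pos ha (show 0 < -(a ^ 2 + 9 * b) by linarith)]
  have hm0 : a * b < c₀ a b := by unfold c₀; linarith
  have hz0 : c₀ a b < 0 := by
    unfold c₀
    nlinarith [mul_pos ha (neg_pos.2 hb), pow_pos ha 3]
  refine valid_six (by grind -mbtc (splits := 30)) (fun h => ?_) (fun ⟨h1, h2⟩ => ?_)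
    (fun ⟨h1, h2⟩ => ?_) (fun ⟨h1, h2⟩ => ?_) (fun ⟨h1, h2⟩ => ?_) (fun h => ?_)
  · obtain ⟨x, hx, _⟩ := exists_single_lt_ξ₁ hb3 (by linarith)
    have := hx.neg_one_add_lt (M := max a (max |b| c)) (by simp) (by simp) (by simp)
    refine hx.oneRoot ?_ ?_ <;> grind -mbtc [LtUnless]
  · obtain ⟨x₃, x₂, x₁, h, l, r⟩ :=
      s1.of_between sz (neg_le_neg_iff.1 h1) (by linarith)
    have := h.isZero₂.neg_div_lt_of_neg hb (by linarith) (by grind)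
    have : 0 < -c / b := div_pos_of_neg_of_neg (by linarith) hb
    refine h.threeRoots ?_ ?_ ?_ ?_ ?_ <;> grind -mbtc [LtUnless]
  · obtain ⟨x₃, x₂, x₁, h, l, r⟩ :=
      sz.of_between s0 (by linarith) (neg_lt_neg_iff.1 h2)
    have : c ≠ 0 → -c / b < x₂ := fun hc => h.isZero₂.neg_div_lt_of_neg hb hc (by grind)
    have := h.isZero₂.neg_div_le_of_neg hb (by grind)
    refine h.threeRoots ?_ ?_ ?_ ?_ ?_ <;> grind -mbtc [LtUnless]
  · obtain ⟨x₃, x₂, x₁, h, l, r⟩ :=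
      s0.of_between sm (neg_le_neg_iff.1 h1) (neg_lt_neg_iff.1 h2)
    have := h.isZero₂.neg_div_lt_of_neg hb (by linarith) (by grind)
    -- At a root (y + a)(y² + b) = ab − c < 0, so y < −a forces y² > −b. Then y is below both −a and
    -- −√(−b), hence at most μ₂.
    have : ∀ y, IsZero a b c y → y < -a → y ≤ -√(-b) := fun y hy hya => by
      have hs := Real.sq_sqrt (neg_pos.2 hb).le
      unfold IsZero at hy
      by_contra! hys
      nlinarith [mul_nonneg (show 0 ≤ -a - y by linarith)
        (mul_nonneg (show 0 ≤ y + √(-b) by linarith) (show 0 ≤ √(-b) - y by linarith))]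
    have : ∀ y, IsZero a b c y → -c / b < y → -a < y := fun y hy hyc => by
      by_contra! hya
      exact (hy.le_neg_div_of_neg hb hya).not_gt hyc
    refine h.threeRoots ?_ ?_ ?_ ?_ ?_ <;> grind -mbtc [LtUnless]
  · obtain ⟨x₃, x₂, x₁, h, l, r⟩ :=
      sm.of_between_le s2 (neg_le_neg_iff.1 h1) (neg_le_neg_iff.1 h2)
    have : max (-a) (-√(-b)) < 0 := max_lt (by linarith) (by linarith)
    refine h.threeRoots ?_ ?_ ?_ ?_ ?_ <;> grind -mbtc [LtUnless]
  · obtain ⟨x, hx, _⟩ := exists_single_ξ₂_lt hb3 (by linarith)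
    have := hx.lt_one_add_sqrt (M := max |b| |c|) ha.le (by simp) (by simp [neg_le_abs])
    refine hx.oneRoot ?_ ?_ <;> grind -mbtc [LtUnless]

theorem valid_regime2Neg (hb9 : -(a ^ 2 / 9) ≤ b) (hb : b < 0) (ha : a < 0) :
    Valid (regime2Neg a b c) := by
  have hb3 : b ≤ a ^ 2 / 3 := by nlinarith
  obtain ⟨s0, s1, s2, _, _, ho⟩ := landmarks hb3
  have sz := split_zero_of_nonpos (a := a) hb.le
  -- The condition b ≥ −a²/9 resolves the minimum and maximum of −a and √(−b), and it also reverses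
  -- the order of c₀ and ab.
  have hs : √(-b) ≤ -a / 3 := Real.sqrt_le_iff.2 ⟨by linarith, by linarith⟩
  have sm := split_mul_of_nonpos ha.le hb.le
  rw [min_eq_right (by linarith), max_eq_left (by linarith)] at sm
  have iz := sz.interlace
  have im := sm.interlace
  have hμ := μ_sign_of_neg (a := a) hb
  have hlam := lam_sign_of_neg (a := a) hb
  have hs0 := Real.sqrt_pos.2 (neg_pos.2 hb)
  have ⟨_, _⟩ := sz.mem_Icc
  have ⟨_, _⟩ := sm.mem_Icc
  have := mul_nonneg (neg_nonneg.2 ha.le) (show 0 ≤ a ^ 2 + 9 * b by linarith)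
  have hm0 : a * b ≤ c₀ a b := by unfold c₀; linarith
  have hzm : 0 < a * b := by nlinarith
  refine valid_six (by grind -mbtc (splits := 30)) (fun h => ?_) (fun ⟨h1, h2⟩ => ?_)
    (fun ⟨h1, h2⟩ => ?_) (fun ⟨h1, h2⟩ => ?_) (fun ⟨h1, h2⟩ => ?_) (fun h => ?_)
  · obtain ⟨x, hx, _⟩ := exists_single_lt_ξ₁ hb3 (by linarith)
    have := hx.neg_one_add_sqrt_lt (M := max |b| c) ha.le (by simp) (by simp)
    refine hx.oneRoot ?_ ?_ <;> grind -mbtc [LtUnless]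
  · obtain ⟨x₃, x₂, x₁, h, l, r⟩ :=
      s1.of_between s0 (neg_le_neg_iff.1 h1) (neg_lt_neg_iff.1 h2)
    refine h.threeRoots ?_ ?_ ?_ ?_ ?_ <;> grind -mbtc [LtUnless]
  · obtain ⟨x₃, x₂, x₁, h, l, r⟩ :=
      s0.of_between sm (neg_le_neg_iff.1 h1) (neg_lt_neg_iff.1 h2)
    refine h.threeRoots ?_ ?_ ?_ ?_ ?_ <;> grind -mbtc [LtUnless]
  · obtain ⟨x₃, x₂, x₁, h, l, r⟩ :=
      sm.of_between sz (neg_le_neg_iff.1 h1) (by linarith)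
    have := h.isZero₂.le_neg_div_of_neg hb (by grind)
    refine h.threeRoots ?_ ?_ ?_ ?_ ?_ <;> grind -mbtc [LtUnless]
  · obtain ⟨x₃, x₂, x₁, h, l, r⟩ :=
      sz.of_between_le s2 (by linarith) (neg_le_neg_iff.1 h2)
    have := h.isZero₂.le_neg_div_of_neg hb (by grind)
    have : -c / b ≤ 0 := div_nonpos_of_nonneg_of_nonpos h1 hb.le
    refine h.threeRoots ?_ ?_ ?_ ?_ ?_ <;> grind -mbtc [LtUnless]
  · obtain ⟨x, hx, _⟩ := exists_single_ξ₂_lt hb3 (by linarith)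
    have := hx.lt_one_add (M := max |a| (max |b| |c|)) (by simp [neg_le_abs]) (by simp)
      (by simp [neg_le_abs])
    refine hx.oneRoot ?_ ?_ <;> grind -mbtc [LtUnless]

theorem valid_regime2Pos (hb9 : -(a ^ 2 / 9) ≤ b) (hb : b < 0) (ha : 0 < a) :
    Valid (regime2Pos a b c) := by
  have hb3 : b ≤ a ^ 2 / 3 := by nlinarith
  obtain ⟨s0, s1, s2, _, _, ho⟩ := landmarks hb3
  have sz := split_zero_of_nonpos (a := a) hb.le
  have hs : √(-b) ≤ a / 3 := Real.sqrt_le_iff.2 ⟨by linarith, by linarith⟩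
  have sm := split_mul_of_nonneg ha.le hb.le
  rw [min_eq_left (by linarith), max_eq_right (by linarith)] at sm
  have iz := sz.interlace
  have im := sm.interlace
  have hμ := μ_sign_of_neg (a := a) hb
  have hlam := lam_sign_of_neg (a := a) hb
  have hs0 := Real.sqrt_pos.2 (neg_pos.2 hb)
  have ⟨_, _⟩ := sz.mem_Icc
  have ⟨_, _⟩ := sm.mem_Icc
  have := mul_nonneg ha.le (show 0 ≤ a ^ 2 + 9 * b by linarith)
  have hm0 : c₀ a b ≤ a * b := by unfold c₀; linarith
  have hzm : a * b < 0 := by nlinarith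
  refine valid_six (by grind -mbtc (splits := 30)) (fun h => ?_) (fun ⟨h1, h2⟩ => ?_)
    (fun ⟨h1, h2⟩ => ?_) (fun ⟨h1, h2⟩ => ?_) (fun ⟨h1, h2⟩ => ?_) (fun h => ?_)
  · obtain ⟨x, hx, _⟩ := exists_single_lt_ξ₁ hb3 (by linarith)
    have := hx.neg_one_add_lt (M := max a (max |b| c)) (by simp) (by simp) (by simp)
    refine hx.oneRoot ?_ ?_ <;> grind -mbtc [LtUnless]
  · obtain ⟨x₃, x₂, x₁, h, l, r⟩ :=
      s1.of_between sz (neg_le_neg_iff.1 h1) (by linarith)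
    have := h.isZero₂.neg_div_lt_of_neg hb (by linarith) (by grind)
    have : 0 < -c / b := div_pos_of_neg_of_neg (by linarith) hb
    refine h.threeRoots ?_ ?_ ?_ ?_ ?_ <;> grind -mbtc [LtUnless]
  · obtain ⟨x₃, x₂, x₁, h, l, r⟩ :=
      sz.of_between sm (by linarith) (neg_lt_neg_iff.1 h2)
    have : c ≠ 0 → -c / b < x₂ := fun hc => h.isZero₂.neg_div_lt_of_neg hb hc (by grind)
    have := h.isZero₂.neg_div_le_of_neg hb (by grind)
    refine h.threeRoots ?_ ?_ ?_ ?_ ?_ <;> grind -mbtc [LtUnless]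
  · obtain ⟨x₃, x₂, x₁, h, l, r⟩ :=
      sm.of_between s0 (neg_le_neg_iff.1 h1) (neg_lt_neg_iff.1 h2)
    refine h.threeRoots ?_ ?_ ?_ ?_ ?_ <;> grind -mbtc [LtUnless]
  · obtain ⟨x₃, x₂, x₁, h, l, r⟩ :=
      s0.of_between_le s2 (neg_le_neg_iff.1 h1) (neg_le_neg_iff.1 h2)
    refine h.threeRoots ?_ ?_ ?_ ?_ ?_ <;> grind -mbtc [LtUnless]
  · obtain ⟨x, hx, _⟩ := exists_single_ξ₂_lt hb3 (by linarith)
    have := hx.lt_one_add_sqrt (M := max |b| |c|) ha.le (by simp) (by simp [neg_le_abs])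
    refine hx.oneRoot ?_ ?_ <;> grind -mbtc [LtUnless]

/-! ### Positive `b` -/

theorem valid_regime4Neg (hb : 0 < b) (hb9 : b ≤ 2 * a ^ 2 / 9) (ha : a < 0) :
    Valid (regime4Neg a b c) := by
  have hb3 : b ≤ a ^ 2 / 3 := by nlinarith
  obtain ⟨s0, s1, s2, _, _, ho⟩ := landmarks hb3
  have hb4 : b ≤ a ^ 2 / 4 := by nlinarith
  have sz := split_zero_of_neg_of_nonneg ha hb.le hb4
  have hμ := μ₂_pos ha hb hb3
  have iz := sz.interlace
  have hlam := lam₂_pos ha hb hb4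
  have ⟨_, _⟩ := sz.mem_Icc
  -- The double root μ₂ lies below −a.
  have hm : a * b < c₂ a b := s2.isZero₃.mul_lt hb (by grind)
  have := mul_nonneg (neg_nonneg.2 ha.le) (show 0 ≤ 2 * a ^ 2 - 9 * b by linarith)
  have hz0 : 0 ≤ c₀ a b := by unfold c₀; linarith
  refine valid_six (by grind -mbtc (splits := 30)) (fun h => ?_) (fun ⟨h1, h2⟩ => ?_)
    (fun ⟨h1, h2⟩ => ?_) (fun ⟨h1, h2⟩ => ?_) (fun ⟨h1, h2⟩ => ?_) (fun h => ?_)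
  · obtain ⟨x, hx, _⟩ := exists_single_lt_ξ₁ hb3 (by linarith)
    have := hx.lt (isZero_zero a b) (by linarith)
    have := hx.neg_div_lt hb (by linarith) (by linarith)
    refine hx.oneRoot ?_ ?_ <;> grind -mbtc [LtUnless]
  · obtain ⟨x₃, x₂, x₁, h, l, r⟩ :=
      s1.of_between s0 (neg_le_neg_iff.1 h1) (neg_lt_neg_iff.1 h2)
    have := h.isZero₃.neg_div_le_of_pos hb (by grind)
    have := (sz.lt h (by linarith)).1
    refine h.threeRoots ?_ ?_ ?_ ?_ ?_ <;> grind -mbtc [LtUnless]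
  · obtain ⟨x₃, x₂, x₁, h, l, r⟩ :=
      s0.of_between sz (neg_le_neg_iff.1 h1) (by linarith)
    have := h.isZero₃.neg_div_le_of_pos hb (by grind)
    refine h.threeRoots ?_ ?_ ?_ ?_ ?_ <;> grind -mbtc [LtUnless]
  · obtain ⟨x₃, x₂, x₁, h, l, r⟩ :=
      sz.of_between_le s2 (by linarith) (neg_le_neg_iff.1 h2)
    have := h.isZero₃.neg_div_le_of_pos hb (by grind)
    refine h.threeRoots ?_ ?_ ?_ ?_ ?_ <;> grind -mbtc [LtUnless]
  · obtain ⟨x, hx, _⟩ := exists_single_ξ₂_lt hb3 (by linarith)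
    have := hx.neg_div_lt hb (by linarith) (by linarith)
    refine hx.oneRoot ?_ ?_ <;> grind -mbtc [LtUnless]
  · obtain ⟨x, hx, _⟩ := exists_single_ξ₂_lt hb3 (by linarith)
    have := hx.ltUnless_neg_div hb (by linarith) (by linarith)
    refine hx.oneRoot ?_ ?_ <;> grind -mbtc [LtUnless]

theorem valid_regime4Pos (hb : 0 < b) (hb9 : b ≤ 2 * a ^ 2 / 9) (ha : 0 < a) :
    Valid (regime4Pos a b c) := by
  have hb3 : b ≤ a ^ 2 / 3 := by nlinarith
  obtain ⟨s0, s1, s2, _, _, ho⟩ := landmarks hb3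
  have hb4 : b ≤ a ^ 2 / 4 := by nlinarith
  have sz := split_zero_of_pos_of_nonneg ha hb.le hb4
  have hμ := μ₁_neg ha hb hb3
  have iz := sz.interlace
  have hlam := lam₁_neg ha hb hb4
  have ⟨_, _⟩ := sz.mem_Icc
  have hm : c₁ a b < a * b := s1.isZero₁.lt_mul hb (by grind)
  have := mul_nonneg ha.le (show 0 ≤ 2 * a ^ 2 - 9 * b by linarith)
  have hz0 : c₀ a b ≤ 0 := by unfold c₀; linarith
  refine valid_six (by grind -mbtc (splits := 30)) (fun h => ?_) (fun ⟨h1, h2⟩ => ?_)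
    (fun ⟨h1, h2⟩ => ?_) (fun ⟨h1, h2⟩ => ?_) (fun ⟨h1, h2⟩ => ?_) (fun h => ?_)
  · obtain ⟨x, hx, _⟩ := exists_single_lt_ξ₁ hb3 (by linarith)
    have := hx.neg_div_lt hb (by linarith) (by linarith)
    refine hx.oneRoot ?_ ?_ <;> grind -mbtc [LtUnless]
  · obtain ⟨x, hx, _⟩ := exists_single_lt_ξ₁ hb3 (by linarith)
    have := hx.ltUnless_neg_div hb (by linarith) (by linarith)
    refine hx.oneRoot ?_ ?_ <;> grind -mbtc [LtUnless]
  · obtain ⟨x₃, x₂, x₁, h, l, r⟩ :=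
      s1.of_between sz (neg_le_neg_iff.1 h1) (by linarith)
    have := h.isZero₁.lt_neg_div_of_pos hb (by linarith) (by grind)
    refine h.threeRoots ?_ ?_ ?_ ?_ ?_ <;> grind -mbtc [LtUnless]
  · obtain ⟨x₃, x₂, x₁, h, l, r⟩ :=
      sz.of_between s0 (by linarith) (neg_lt_neg_iff.1 h2)
    have := h.isZero₁.le_neg_div_of_pos hb (by grind)
    have : c ≠ 0 → x₁ < -c / b := fun hc => h.isZero₁.lt_neg_div_of_pos hb hc (by grind)
    refine h.threeRoots ?_ ?_ ?_ ?_ ?_ <;> grind -mbtc [LtUnless]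
  · obtain ⟨x₃, x₂, x₁, h, l, r⟩ :=
      s0.of_between_le s2 (neg_le_neg_iff.1 h1) (neg_le_neg_iff.1 h2)
    have := h.isZero₁.le_neg_div_of_pos hb (by grind)
    -- Equality occurs when b = 2a²/9, where c₀ = 0. Strict positivity of x₁ must therefore come
    -- from c ≠ 0.
    have : 0 ≤ ρ₁ a b := (s0.le sz hz0).2.2
    have : x₁ ∈ {x | LtUnless (c = 0) 0 x} :=
      ⟨by linarith, fun hc => lt_of_le_of_ne (by linarith) (h.isZero₁.ne_zero hc).symm⟩
    refine h.threeRoots ?_ ?_ ?_ ?_ ?_ <;> grind -mbtc [LtUnless]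
  · obtain ⟨x, hx, _⟩ := exists_single_ξ₂_lt hb3 (by linarith)
    have := hx.gt (isZero_zero a b) (by linarith)
    have := hx.lt_neg_div hb (by linarith) (by linarith)
    refine hx.oneRoot ?_ ?_ <;> grind -mbtc [LtUnless]

theorem valid_regime5Neg (hb9 : 2 * a ^ 2 / 9 < b) (hb4 : b ≤ a ^ 2 / 4) (ha : a < 0) :
    Valid (regime5Neg a b c) := by
  have hb : 0 < b := by nlinarith
  have hb3 : b ≤ a ^ 2 / 3 := by nlinarith
  obtain ⟨s0, s1, s2, _, _, ho⟩ := landmarks hb3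
  have sz := split_zero_of_neg_of_nonneg ha hb.le hb4
  have hμ := μ₂_pos ha hb hb3
  have iz := sz.interlace
  have hlam := lam₂_pos ha hb hb4
  have ⟨_, _⟩ := sz.mem_Icc
  have hm : a * b < c₂ a b := s2.isZero₃.mul_lt hb (by grind)
  have := mul_pos (neg_pos.2 ha) (show 0 < 9 * b - 2 * a ^ 2 by linarith)
  have hz0 : c₀ a b < 0 := by unfold c₀; linarith
  refine valid_six (by grind -mbtc (splits := 30)) (fun h => ?_) (fun ⟨h1, h2⟩ => ?_)
    (fun ⟨h1, h2⟩ => ?_) (fun ⟨h1, h2⟩ => ?_) (fun ⟨h1, h2⟩ => ?_) (fun h => ?_)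
  · obtain ⟨x, hx, _⟩ := exists_single_lt_ξ₁ hb3 (by linarith)
    have := hx.lt (isZero_zero a b) (by linarith)
    have := hx.neg_div_lt hb (by linarith) (by linarith)
    refine hx.oneRoot ?_ ?_ <;> grind -mbtc [LtUnless]
  · obtain ⟨x₃, x₂, x₁, h, l, r⟩ :=
      s1.of_between sz (neg_le_neg_iff.1 h1) (by linarith)
    have := h.isZero₃.neg_div_le_of_pos hb (by grind)
    refine h.threeRoots ?_ ?_ ?_ ?_ ?_ <;> grind -mbtc [LtUnless]
  · obtain ⟨x₃, x₂, x₁, h, l, r⟩ :=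
      sz.of_between s0 (by linarith) (neg_lt_neg_iff.1 h2)
    have := h.isZero₃.neg_div_le_of_pos hb (by grind)
    refine h.threeRoots ?_ ?_ ?_ ?_ ?_ <;> grind -mbtc [LtUnless]
  · obtain ⟨x₃, x₂, x₁, h, l, r⟩ :=
      s0.of_between_le s2 (neg_le_neg_iff.1 h1) (neg_le_neg_iff.1 h2)
    have := h.isZero₃.neg_div_le_of_pos hb (by grind)
    have := (s0.lt sz hz0).1
    refine h.threeRoots ?_ ?_ ?_ ?_ ?_ <;> grind -mbtc [LtUnless]
  · obtain ⟨x, hx, _⟩ := exists_single_ξ₂_lt hb3 (by linarith)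
    have := hx.neg_div_ltUnless hb (by linarith) (by linarith)
    refine hx.oneRoot ?_ ?_ <;> grind -mbtc [LtUnless]
  · obtain ⟨x, hx, _⟩ := exists_single_ξ₂_lt hb3 (by linarith)
    have := hx.lt_neg_div hb (by linarith) (by linarith)
    refine hx.oneRoot ?_ ?_ <;> grind -mbtc [LtUnless]

theorem valid_regime5Pos (hb9 : 2 * a ^ 2 / 9 < b) (hb4 : b ≤ a ^ 2 / 4) (ha : 0 < a) :
    Valid (regime5Pos a b c) := by
  have hb : 0 < b := by nlinarith
  have hb3 : b ≤ a ^ 2 / 3 := by nlinarith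
  obtain ⟨s0, s1, s2, _, _, ho⟩ := landmarks hb3
  have sz := split_zero_of_pos_of_nonneg ha hb.le hb4
  have hμ := μ₁_neg ha hb hb3
  have iz := sz.interlace
  have hlam := lam₁_neg ha hb hb4
  have ⟨_, _⟩ := sz.mem_Icc
  have hm : c₁ a b < a * b := s1.isZero₁.lt_mul hb (by grind)
  have := mul_pos ha (show 0 < 9 * b - 2 * a ^ 2 by linarith)
  have hz0 : 0 < c₀ a b := by unfold c₀; linarith
  refine valid_six (by grind -mbtc (splits := 30)) (fun h => ?_) (fun ⟨h1, h2⟩ => ?_)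
    (fun ⟨h1, h2⟩ => ?_) (fun ⟨h1, h2⟩ => ?_) (fun ⟨h1, h2⟩ => ?_) (fun h => ?_)
  · obtain ⟨x, hx, _⟩ := exists_single_lt_ξ₁ hb3 (by linarith)
    have := hx.neg_div_lt hb (by linarith) (by linarith)
    refine hx.oneRoot ?_ ?_ <;> grind -mbtc [LtUnless]
  · obtain ⟨x, hx, _⟩ := exists_single_lt_ξ₁ hb3 (by linarith)
    have := hx.ltUnless_neg_div hb (by linarith) (by linarith)
    refine hx.oneRoot ?_ ?_ <;> grind -mbtc [LtUnless]
  · obtain ⟨x₃, x₂, x₁, h, l, r⟩ :=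
      s1.of_between s0 (neg_le_neg_iff.1 h1) (neg_lt_neg_iff.1 h2)
    have := h.isZero₁.lt_neg_div_of_pos hb (by linarith) (by grind)
    have := (sz.lt h (by linarith)).2.2
    refine h.threeRoots ?_ ?_ ?_ ?_ ?_ <;> grind -mbtc [LtUnless]
  · obtain ⟨x₃, x₂, x₁, h, l, r⟩ :=
      s0.of_between sz (neg_le_neg_iff.1 h1) (by linarith)
    have := h.isZero₁.lt_neg_div_of_pos hb (by linarith) (by grind)
    refine h.threeRoots ?_ ?_ ?_ ?_ ?_ <;> grind -mbtc [LtUnless]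
  · obtain ⟨x₃, x₂, x₁, h, l, r⟩ :=
      sz.of_between_le s2 (by linarith) (neg_le_neg_iff.1 h2)
    have := h.isZero₁.le_neg_div_of_pos hb (by grind)
    refine h.threeRoots ?_ ?_ ?_ ?_ ?_ <;> grind -mbtc [LtUnless]
  · obtain ⟨x, hx, _⟩ := exists_single_ξ₂_lt hb3 (by linarith)
    have := hx.gt (isZero_zero a b) (by linarith)
    have := hx.lt_neg_div hb (by linarith) (by linarith)
    refine hx.oneRoot ?_ ?_ <;> grind -mbtc [LtUnless]

/-- As x² + ax + b has no real zero, c = 0 no longer splits: all of [c₂, c₁] is negative, and ab <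
c₂. -/
theorem valid_regime6Neg (hb4 : a ^ 2 / 4 < b) (hb3 : b ≤ a ^ 2 / 3) (ha : a < 0) :
    Valid (regime6Neg a b c) := by
  have hb : 0 < b := by nlinarith
  obtain ⟨s0, s1, s2, _, _, ho⟩ := landmarks hb3
  have hμ := μ₂_pos ha hb hb3
  have hm : a * b < c₂ a b := s2.isZero₃.mul_lt hb (by grind)
  have hz : c₁ a b < 0 := s1.isZero₁.neg_of_neg hb4 (by linarith)
  refine valid_six (by grind -mbtc (splits := 30)) (fun h => ?_) (fun ⟨h1, h2⟩ => ?_)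
    (fun ⟨h1, h2⟩ => ?_) (fun ⟨h1, h2⟩ => ?_) (fun ⟨h1, h2⟩ => ?_) (fun h => ?_)
  · obtain ⟨x, hx, _⟩ := exists_single_lt_ξ₁ hb3 (by linarith)
    have := hx.lt (isZero_zero a b) (by linarith)
    have := hx.neg_div_lt hb (by linarith) (by linarith)
    refine hx.oneRoot ?_ ?_ <;> grind -mbtc [LtUnless]
  · obtain ⟨x, hx, _⟩ := exists_single_lt_ξ₁ hb3 (by linarith)
    have := hx.ge (isZero_zero a b) (by linarith)
    have := hx.isZero.neg_div_le_of_pos hb (by linarith)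
    refine hx.oneRoot ?_ ?_ <;> grind -mbtc [LtUnless]
  · obtain ⟨x₃, x₂, x₁, h, l, r⟩ :=
      s1.of_between s0 (neg_le_neg_iff.1 h1) (neg_lt_neg_iff.1 h2)
    have := h.isZero₃.neg_div_le_of_pos hb (by grind)
    have := h.isZero₃.pos_of_neg hb4 (by linarith)
    refine h.threeRoots ?_ ?_ ?_ ?_ ?_ <;> grind -mbtc [LtUnless]
  · obtain ⟨x₃, x₂, x₁, h, l, r⟩ :=
      s0.of_between_le s2 (neg_le_neg_iff.1 h1) (neg_le_neg_iff.1 h2)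
    have := h.isZero₃.neg_div_le_of_pos hb (by grind)
    have := h.isZero₃.pos_of_neg hb4 (by linarith)
    refine h.threeRoots ?_ ?_ ?_ ?_ ?_ <;> grind -mbtc [LtUnless]
  · obtain ⟨x, hx, _⟩ := exists_single_ξ₂_lt hb3 (by linarith)
    have := hx.neg_div_ltUnless hb (by linarith) (by linarith)
    refine hx.oneRoot ?_ ?_ <;> grind -mbtc [LtUnless]
  · obtain ⟨x, hx, _⟩ := exists_single_ξ₂_lt hb3 (by linarith)
    have := hx.lt_neg_div hb (by linarith) (by linarith)
    refine hx.oneRoot ?_ ?_ <;> grind -mbtc [LtUnless]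

theorem valid_regime6Pos (hb4 : a ^ 2 / 4 < b) (hb3 : b ≤ a ^ 2 / 3) (ha : 0 < a) :
    Valid (regime6Pos a b c) := by
  have hb : 0 < b := by nlinarith
  obtain ⟨s0, s1, s2, _, _, ho⟩ := landmarks hb3
  have hμ := μ₁_neg ha hb hb3
  have hm : c₁ a b < a * b := s1.isZero₁.lt_mul hb (by grind)
  have hz : 0 < c₂ a b := s2.isZero₃.pos_of_pos hb4 (by linarith)
  refine valid_six (by grind -mbtc (splits := 30)) (fun h => ?_) (fun ⟨h1, h2⟩ => ?_)
    (fun ⟨h1, h2⟩ => ?_) (fun ⟨h1, h2⟩ => ?_) (fun ⟨h1, h2⟩ => ?_) (fun h => ?_)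
  · obtain ⟨x, hx, _⟩ := exists_single_lt_ξ₁ hb3 (by linarith)
    have := hx.neg_div_lt hb (by linarith) (by linarith)
    refine hx.oneRoot ?_ ?_ <;> grind -mbtc [LtUnless]
  · obtain ⟨x, hx, _⟩ := exists_single_lt_ξ₁ hb3 (by linarith)
    have := hx.ltUnless_neg_div hb (by linarith) (by linarith)
    refine hx.oneRoot ?_ ?_ <;> grind -mbtc [LtUnless]
  · obtain ⟨x₃, x₂, x₁, h, l, r⟩ :=
      s1.of_between s0 (neg_le_neg_iff.1 h1) (neg_lt_neg_iff.1 h2)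
    have := h.isZero₁.lt_neg_div_of_pos hb (by linarith) (by grind)
    have := h.isZero₁.neg_of_pos hb4 (by linarith)
    refine h.threeRoots ?_ ?_ ?_ ?_ ?_ <;> grind -mbtc [LtUnless]
  · obtain ⟨x₃, x₂, x₁, h, l, r⟩ :=
      s0.of_between_le s2 (neg_le_neg_iff.1 h1) (neg_le_neg_iff.1 h2)
    have := h.isZero₁.lt_neg_div_of_pos hb (by linarith) (by grind)
    have := h.isZero₁.neg_of_pos hb4 (by linarith)
    have : c ≠ c₂ a b → x₁ < ξ₂ a b := fun hc => (s2.lt h (by grind)).2.2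
    refine h.threeRoots ?_ ?_ ?_ ?_ ?_ <;> grind -mbtc [LtUnless]
  · obtain ⟨x, hx, _⟩ := exists_single_ξ₂_lt hb3 (by linarith)
    have := hx.le (isZero_zero a b) (by linarith)
    have := hx.isZero.le_neg_div_of_pos hb (by linarith)
    refine hx.oneRoot ?_ ?_ <;> grind -mbtc [LtUnless]
  · obtain ⟨x, hx, _⟩ := exists_single_ξ₂_lt hb3 (by linarith)
    have := hx.gt (isZero_zero a b) (by linarith)
    have := hx.lt_neg_div hb (by linarith) (by linarith)
    refine hx.oneRoot ?_ ?_ <;> grind -mbtc [LtUnless]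

/-- The cubic has a single real root for every c. Only the landmarks 0, −a/3 and −a remain, at the
free terms 0 > c₀ > ab. -/
theorem valid_regime7Neg (hb3 : a ^ 2 / 3 < b) (ha : a < 0) :
    Valid (regime7Neg a b c) := by
  have hb : 0 < b := by nlinarith
  have hρ : ρ₀ a = -a / 3 := rfl
  have := mul_pos (neg_pos.2 ha) hb
  have := mul_pos (neg_pos.2 ha) (show 0 < 9 * b - 2 * a ^ 2 by nlinarith)
  have := pow_pos (neg_pos.2 ha) 3
  have hz0 : c₀ a b < 0 := by unfold c₀; linarith
  have hm0 : a * b < c₀ a b := by unfold c₀; linarith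
  refine valid_four (by grind -mbtc) (fun h => ?_) (fun ⟨h1, h2⟩ => ?_) (fun ⟨h1, h2⟩ => ?_)
    (fun h => ?_)
  · obtain ⟨x, hx⟩ := exists_single_of_lt hb3
    have := hx.lt (isZero_zero a b) (by linarith)
    have := hx.neg_div_lt hb (by linarith) (by linarith)
    refine hx.oneRoot ?_ ?_ <;> grind -mbtc [LtUnless]
  · obtain ⟨x, hx⟩ := exists_single_of_lt hb3
    have := hx.ge (isZero_zero a b) (by linarith)
    have := hx.lt (isZero_ρ₀ a b) (by linarith)
    have := hx.isZero.neg_div_le_of_pos hb (by linarith)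
    refine hx.oneRoot ?_ ?_ <;> grind -mbtc [LtUnless]
  · obtain ⟨x, hx⟩ := exists_single_of_lt hb3
    have := hx.ge (isZero_ρ₀ a b) (by linarith)
    have := hx.neg_div_lt hb (by linarith) (by linarith)
    refine hx.oneRoot ?_ ?_ <;> grind -mbtc [LtUnless]
  · obtain ⟨x, hx⟩ := exists_single_of_lt hb3
    have := hx.ltUnless_neg_div hb (by linarith) (by linarith)
    refine hx.oneRoot ?_ ?_ <;> grind -mbtc [LtUnless]

theorem valid_regime7Pos (hb3 : a ^ 2 / 3 < b) (ha : 0 < a) :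
    Valid (regime7Pos a b c) := by
  have hb : 0 < b := by nlinarith
  have hρ : ρ₀ a = -a / 3 := rfl
  have := mul_pos ha hb
  have := mul_pos ha (show 0 < 9 * b - 2 * a ^ 2 by nlinarith)
  have := pow_pos ha 3
  have hz0 : 0 < c₀ a b := by unfold c₀; linarith
  have hm0 : c₀ a b < a * b := by unfold c₀; linarith
  refine valid_four (by grind -mbtc) (fun h => ?_) (fun ⟨h1, h2⟩ => ?_) (fun ⟨h1, h2⟩ => ?_)
    (fun h => ?_)
  · obtain ⟨x, hx⟩ := exists_single_of_lt hb3
    have := hx.neg_div_lt hb (by linarith) (by linarith)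
    refine hx.oneRoot ?_ ?_ <;> grind -mbtc [LtUnless]
  · obtain ⟨x, hx⟩ := exists_single_of_lt hb3
    have := hx.lt (isZero_ρ₀ a b) (by linarith)
    have := hx.ltUnless_neg_div hb (by linarith) (by linarith)
    refine hx.oneRoot ?_ ?_ <;> grind -mbtc [LtUnless]
  · obtain ⟨x, hx⟩ := exists_single_of_lt hb3
    have := hx.ge (isZero_ρ₀ a b) (by linarith)
    have := hx.lt (isZero_zero a b) (by linarith)
    have := hx.lt_neg_div hb (by linarith) (by linarith)
    refine hx.oneRoot ?_ ?_ <;> grind -mbtc [LtUnless]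
  · obtain ⟨x, hx⟩ := exists_single_of_lt hb3
    have := hx.ge (isZero_zero a b) (by linarith)
    have := hx.isZero.le_neg_div_of_pos hb (by linarith)
    have : c ≠ 0 → x < -c / b := fun hc => hx.isZero.lt_neg_div_of_pos hb hc (by linarith)
    refine hx.oneRoot ?_ ?_ <;> grind -mbtc [LtUnless]

/-! ### Depressed cubics with `0 ≤ b` -/

theorem realCbrt_pow (y : ℝ) : realCbrt y ^ 3 = y := by
  have key : ∀ z : ℝ, 0 ≤ z → (z ^ (1 / 3 : ℝ)) ^ 3 = z := fun z hz => by
    rw [← Real.rpow_natCast, ← Real.rpow_mul hz]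
    norm_num
  unfold realCbrt
  split_ifs with h
  · exact key y h
  · rw [Odd.neg_pow (by decide), key _ (by linarith), neg_neg]

theorem valid_depressedZero (ha : a = 0) (hb : b = 0) : Valid (depressedZero a b c) := by
  subst ha hb
  have hz : IsZero 0 0 c (realCbrt (-c)) := by
    unfold IsZero; rw [realCbrt_pow]; ring
  have hs : c ≠ 0 → Single 0 0 c (realCbrt (-c)) := fun hc => by
    -- The discriminant condition reduces to 0 < c².
    obtain ⟨x, hx⟩ := exists_single (a := 0) (b := 0) (c := c)
      (by simp only [c₀]; norm_num; positivity)
    rwa [hx.eq hz]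
  refine ⟨?_, ?_, ?_⟩
  · rcases lt_trichotomy (-c) 0 with h | h | h <;> simp only [depressedZero] <;> simp [h]
  · simp only [depressedZero, List.pairwise_cons, List.forall_mem_cons, List.not_mem_nil,
      false_imp_iff, implies_true, and_true, List.Pairwise.nil]
    grind
  · simp only [depressedZero, List.forall_mem_cons, List.not_mem_nil, false_imp_iff, implies_true,
      and_true]
    refine ⟨fun h => ?_, fun h => ?_, fun h => ?_⟩
    · have hx := hs (by rintro rfl; simp at h)
      exact hx.oneRoot (mem_Iio.2 (hx.lt (isZero_zero 0 0) (by linarith))) rfl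
    · have h0 : Split 0 0 c 0 0 0 :=
        ⟨le_rfl, le_rfl, by simp, by simp, by linarith⟩
      have hμ : μ₁ 0 0 = 0 ∧ μ₂ 0 0 = 0 := by simp [μ₁, μ₂]
      refine h0.threeRoots ⟨rfl, rfl, rfl⟩ ⟨rfl, rfl, rfl⟩ ?_ ?_ ?_ <;> rintro y - (rfl : y = 0)
      · exact hμ.2.ge
      · exact ⟨hμ.2.le, hμ.1.ge⟩
      · exact hμ.1.le
    · have hx := hs (by rintro rfl; simp at h)
      exact hx.oneRoot (mem_Ioi.2 (hx.gt (isZero_zero 0 0) (by linarith))) rfl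

theorem valid_depressedPos (ha : a = 0) (hb : 0 < b) : Valid (depressedPos a b c) := by
  subst ha
  obtain ⟨x, hx⟩ := exists_single_of_lt (a := 0) (c := c) (by simpa using hb)
  refine ⟨?_, ?_, ?_⟩
  · rcases le_or_gt (-c) 0 with h | h <;> simp only [depressedPos] <;> simp [h]
  · simp only [depressedPos, List.pairwise_cons, List.forall_mem_cons, List.not_mem_nil,
      false_imp_iff, implies_true, and_true, List.Pairwise.nil]
    grind
  · simp only [depressedPos, List.forall_mem_cons, List.not_mem_nil, false_imp_iff, implies_true,
      and_true]
    refine ⟨fun h => ?_, fun h => ?_⟩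
    · have h0 := hx.le (isZero_zero 0 b) (by linarith)
      refine hx.oneRoot h0 ⟨⟨hx.isZero.neg_div_le_of_pos hb (by simpa using h0), fun hc => ?_⟩, h0⟩
      exact hx.isZero.neg_div_lt_of_pos hb hc (by simpa using h0.lt_of_ne (hx.isZero.ne_zero hc))
    · have h0 := hx.gt (isZero_zero 0 b) (by linarith)
      exact hx.oneRoot h0 ⟨h0, hx.isZero.lt_neg_div_of_pos hb (by linarith) (by simpa using h0)⟩

/-! ### Cubics with `b = 0` -/

theorem values_regime3Neg (hb : b = 0) (ha : a < 0) : regime3NegValues a b := by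
  subst hb
  have h3 : √3 * √3 = 3 := Real.mul_self_sqrt (by norm_num)
  have hs : √(a ^ 2 / 3 - 0) = -(√3 / 3) * a := by
    -- The minus sign makes the base nonnegative, since a < 0.
    rw [show a ^ 2 / 3 - 0 = (-(√3 / 3) * a) ^ 2 by linear_combination (-a ^ 2 / 9) * h3,
      Real.sqrt_sq (by have := Real.sqrt_nonneg 3; nlinarith)]
  have hg : halfGap a 0 = -a / 3 := by
    unfold halfGap; rw [hs]; linear_combination (-a / 9) * h3
  have hle : (0 : ℝ) ≤ a ^ 2 / 3 := by positivity
  refine ⟨?_, ?_, ?_, ?_, ?_, ?_, ?_, ?_⟩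
  · rw [c₁_eq hle, hg, c₀]; ring
  · rw [c₀]; ring
  · rw [c₂_eq hle, hg, c₀]; ring
  · rw [ξ₁_eq, hg]; ring
  · rw [μ₁_eq, hg]; ring
  · rw [ρ₀]; ring
  · rw [ρ₁, hs]; ring
  · rw [ρ₂, hs]; ring

theorem values_regime3Pos (hb : b = 0) (ha : 0 < a) : regime3PosValues a b := by
  subst hb
  have h3 : √3 * √3 = 3 := Real.mul_self_sqrt (by norm_num)
  have hs : √(a ^ 2 / 3 - 0) = √3 / 3 * a := by
    rw [show a ^ 2 / 3 - 0 = (√3 / 3 * a) ^ 2 by linear_combination (-a ^ 2 / 9) * h3,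
      Real.sqrt_sq (by positivity)]
  have hg : halfGap a 0 = a / 3 := by
    unfold halfGap; rw [hs]; linear_combination (a / 9) * h3
  have hle : (0 : ℝ) ≤ a ^ 2 / 3 := by positivity
  refine ⟨?_, ?_, ?_, ?_, ?_, ?_, ?_, ?_⟩
  · rw [c₁_eq hle, hg, c₀]; ring
  · rw [c₀]; ring
  · rw [c₂_eq hle, hg, c₀]; ring
  · rw [ξ₂_eq, hg]; ring
  · rw [μ₂_eq, hg]; ring
  · rw [ρ₀]; ring
  · rw [ρ₁, hs]; ring
  · rw [ρ₂, hs]; ring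

theorem values_depressedNeg (ha : a = 0) : depressedNegValues a b := by
  subst ha
  have hc : √((0 ^ 2 - 3 * b) ^ 3) = 3 * √3 * √(-b ^ 3) := by
    rw [show (0 ^ 2 - 3 * b) ^ 3 = 3 ^ 2 * 3 * -b ^ 3 by ring,
      Real.sqrt_mul (by norm_num), Real.sqrt_mul (by norm_num), Real.sqrt_sq (by norm_num)]
  have hs : √(0 ^ 2 / 3 - b) = √(-b) := by norm_num
  unfold depressedNegValues c₁ c₂ c₀ μ₁ μ₂ ξ₁ ξ₂
  rw [hc, hs]
  refine ⟨?_, ?_, ?_, ?_, ?_, ?_⟩ <;> ring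

theorem valid_regime3Neg (hb : b = 0) (ha : a < 0) : Valid (regime3Neg a b c) := by
  obtain ⟨v1, v0, v2, -, -, -, -, -⟩ := values_regime3Neg hb ha
  subst hb
  have hb3 : (0 : ℝ) ≤ a ^ 2 / 3 := by positivity
  have s0 := split_c₀ hb3
  have s1 := split_c₁ hb3
  -- The cubic x²(x + a): for b = 0 the special values 0, ab and c₂ coincide.
  have sz : Split a 0 0 0 0 (-a) := ⟨le_rfl, by linarith, by ring, by ring, by ring⟩
  have i0 := s0.interlace
  have i1 := s1.interlace
  have iz := sz.interlace
  have hρ : ρ₀ a = -a / 3 := rfl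
  have ha3 : a ^ 3 < 0 := Odd.pow_neg (by decide) ha
  have hz0 : 0 < c₀ a 0 := by linarith
  have h01 := sz.lt s0 hz0
  refine valid_four (by grind -mbtc) (fun h => ?_) (fun ⟨h1, h2⟩ => ?_)
    (fun ⟨h1, h2⟩ => ?_) (fun h => ?_)
  · obtain ⟨x, hx⟩ := exists_single_of_c₁_lt hb3 (neg_lt_neg_iff.1 h)
    have := hx.lt s1.isZero₃ (by linarith)
    have := hx.lt (isZero_zero a 0) (by linarith)
    refine hx.oneRoot this ⟨hx.lt_of_neg ?_, by assumption⟩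
    -- With m = max 1 c, the value at −m is −m³ + am² + c < m − m³ ≤ 0, using a < 0 and c ≤ m.
    have hm : 1 ≤ max 1 c := le_max_left _ _
    nlinarith [le_max_right 1 c, pow_pos (zero_lt_one.trans_le hm) 2,
      mul_nonneg (sub_nonneg.2 hm) (sub_nonneg.2 hm)]
  · obtain ⟨x₃, x₂, x₁, h, l, r⟩ := s1.of_between s0 (neg_le_neg_iff.1 h1) (neg_lt_neg_iff.1 h2)
    have := (sz.lt h (by linarith)).1
    refine h.threeRoots ?_ ?_ ?_ ?_ ?_ <;> grind -mbtc [LtUnless]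
  · obtain ⟨x₃, x₂, x₁, h, l, r⟩ := s0.of_between_le sz (neg_le_neg_iff.1 h1) (by linarith)
    have k : c ≠ 0 → _ := fun hc => sz.lt h (lt_of_le_of_ne (by linarith) hc.symm)
    refine h.threeRoots ?_ ?_ ?_ ?_ ?_ <;> grind -mbtc [LtUnless]
  · obtain ⟨x, hx⟩ := exists_single_of_lt_c₂ hb3 (by linarith)
    have := hx.gt sz.isZero₁ (by linarith)
    have := hx.lt_one_add (M := max |a| |c|) (by simp [neg_le_abs]) (by simp) (by simp [neg_le_abs])
    exact hx.oneRoot (mem_Ioi.2 (by linarith)) ⟨by assumption, this⟩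

theorem valid_regime3Pos (hb : b = 0) (ha : 0 < a) : Valid (regime3Pos a b c) := by
  obtain ⟨v1, v0, v2, v3, -, -, -, -⟩ := values_regime3Pos hb ha
  subst hb
  have hb3 : (0 : ℝ) ≤ a ^ 2 / 3 := by positivity
  have s0 := split_c₀ hb3
  have s2 := split_c₂ hb3
  have sz : Split a 0 0 (-a) 0 0 := ⟨by linarith, le_rfl, by ring, by ring, by ring⟩
  have i0 := s0.interlace
  have i2 := s2.interlace
  have iz := sz.interlace
  have hρ : ρ₀ a = -a / 3 := rfl
  have ha3 : 0 < a ^ 3 := by positivity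
  have hz0 : c₀ a 0 < 0 := by linarith
  have h01 := s0.lt sz hz0
  refine valid_four (by grind -mbtc) (fun h => ?_) (fun ⟨h1, h2⟩ => ?_)
    (fun ⟨h1, h2⟩ => ?_) (fun h => ?_)
  · obtain ⟨x, hx⟩ := exists_single_of_c₁_lt hb3 (c := c) (by linarith)
    have := hx.lt sz.isZero₃ (by linarith)
    have := hx.neg_one_add_lt (M := max a |c|) (by simp) (by simp [ha.le]) (by simp [le_abs_self])
    exact hx.oneRoot (mem_Iio.2 (by linarith)) ⟨this, by assumption⟩
  · obtain ⟨x₃, x₂, x₁, h, l, r⟩ := sz.of_between s0 (by linarith) (neg_lt_neg_iff.1 h2)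
    have k : c ≠ 0 → _ := fun hc => h.lt sz (lt_of_le_of_ne (by linarith) hc)
    have hx1 : LtUnless (c = 0) 0 x₁ := ⟨r.2.1, fun hc => (k hc).2.2⟩
    exact h.threeRoots ⟨mem_Iio.2 (by linarith), mem_Iic.2 r.1.2, hx1⟩ (by grind -mbtc)
      (by grind -mbtc) (by grind -mbtc) (by grind -mbtc)
  · obtain ⟨x₃, x₂, x₁, h, l, r⟩ :=
      s0.of_between_le s2 (neg_le_neg_iff.1 h1) (neg_le_neg_iff.1 h2)
    have k : c ≠ c₂ a 0 → _ := fun hc => s2.lt h (lt_of_le_of_ne (by linarith) hc.symm)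
    refine h.threeRoots ?_ ?_ ?_ ?_ ?_ <;> grind -mbtc [LtUnless]
  · obtain ⟨x, hx⟩ := exists_single_of_lt_c₂ hb3 (neg_lt_neg_iff.1 h)
    have := hx.gt s2.isZero₁ (by linarith)
    refine hx.oneRoot (mem_Ioi.2 (by linarith)) ⟨this.le, hx.lt_of_pos ?_⟩
    have hm : 1 ≤ max 1 |c| := le_max_left _ _
    nlinarith [le_max_right 1 |c|, neg_le_abs c, pow_pos (zero_lt_one.trans_le hm) 2,
      mul_nonneg (sub_nonneg.2 hm) (sub_nonneg.2 hm)]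

end MonicCubic

end

theorem mainTheorem1 (a b c : ℝ) :
    (a = 0 → b < 0 → MonicCubic.depressedNegValues a b ∧
      MonicCubic.Valid (MonicCubic.depressedNeg a b c)) ∧
    (a = 0 → b = 0 → MonicCubic.Valid (MonicCubic.depressedZero a b c)) ∧
    (a = 0 → 0 < b → MonicCubic.Valid (MonicCubic.depressedPos a b c)) ∧
    (b < -(a ^ 2 / 9) → a < 0 → MonicCubic.Valid (MonicCubic.regime1Neg a b c)) ∧
    (b < -(a ^ 2 / 9) → 0 < a → MonicCubic.Valid (MonicCubic.regime1Pos a b c)) ∧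
    (-(a ^ 2 / 9) ≤ b → b < 0 → a < 0 → MonicCubic.Valid (MonicCubic.regime2Neg a b c)) ∧
    (-(a ^ 2 / 9) ≤ b → b < 0 → 0 < a → MonicCubic.Valid (MonicCubic.regime2Pos a b c)) ∧
    (b = 0 → a < 0 → MonicCubic.regime3NegValues a b ∧
      MonicCubic.Valid (MonicCubic.regime3Neg a b c)) ∧
    (b = 0 → 0 < a → MonicCubic.regime3PosValues a b ∧
      MonicCubic.Valid (MonicCubic.regime3Pos a b c)) ∧
    (0 < b → b ≤ 2 * a ^ 2 / 9 → a < 0 → MonicCubic.Valid (MonicCubic.regime4Neg a b c)) ∧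
    (0 < b → b ≤ 2 * a ^ 2 / 9 → 0 < a → MonicCubic.Valid (MonicCubic.regime4Pos a b c)) ∧
    (2 * a ^ 2 / 9 < b → b ≤ a ^ 2 / 4 → a < 0 →
      MonicCubic.Valid (MonicCubic.regime5Neg a b c)) ∧
    (2 * a ^ 2 / 9 < b → b ≤ a ^ 2 / 4 → 0 < a →
      MonicCubic.Valid (MonicCubic.regime5Pos a b c)) ∧
    (a ^ 2 / 4 < b → b ≤ a ^ 2 / 3 → a < 0 → MonicCubic.Valid (MonicCubic.regime6Neg a b c)) ∧
    (a ^ 2 / 4 < b → b ≤ a ^ 2 / 3 → 0 < a → MonicCubic.Valid (MonicCubic.regime6Pos a b c)) ∧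
    (a ^ 2 / 3 < b → a < 0 → MonicCubic.Valid (MonicCubic.regime7Neg a b c)) ∧
    (a ^ 2 / 3 < b → 0 < a → MonicCubic.Valid (MonicCubic.regime7Pos a b c)) := by
  open MonicCubic in
  exact ⟨fun ha hb => ⟨values_depressedNeg ha, valid_depressedNeg ha hb⟩,
    valid_depressedZero, valid_depressedPos, valid_regime1Neg, valid_regime1Pos,
    valid_regime2Neg, valid_regime2Pos,
    fun hb ha => ⟨values_regime3Neg hb ha, valid_regime3Neg hb ha⟩,
    fun hb ha => ⟨values_regime3Pos hb ha, valid_regime3Pos hb ha⟩,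
    valid_regime4Neg, valid_regime4Pos, valid_regime5Neg, valid_regime5Pos,
    valid_regime6Neg, valid_regime6Pos, valid_regime7Neg, valid_regime7Pos⟩
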